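/- Fix a set $\mathcal{O}$ and $n\ge 1$. Categories with object set $\mathcal{O}$ and identity-on-objects functors form the category $\mathsf{Cat}_{\mathcal{O}}$, and an $n$-track category is a category with object set $\mathcal{O}$ enriched in weakly globular $n$-fold groupoids; through multinerves, the category $\mathsf{Track}^n_{\mathcal O}$ of $n$-track categories is a full subcategory of the category of $n$-fold simplicial objects in $\mathsf{Cat}_{\mathcal{O}}$. Let $p^{(1)}$ be the truncation functor from $n$-track categories to track categories ($1$-track categories, i.e. groupoids in $\mathsf{Cat}_{\mathcal O}$), obtained by passing to isomorphism classes in the last groupoid direction, $n-1$ times, and let $d^{(n)}$ denote the inclusion of track categories as $n$-fold objects which are discrete in all directions but the first. Every $n$-track category $Y$ has a canonical map $Y\to d^{(n)}p^{(1)}Y$. Let $(\mathcal{K},\varepsilon,\delta)$ be the comonad on $n$-track categories given by the right adjoint functor sending $Y$ to the graph on $\mathcal{O}$ underlying the category $Y_{1\cdots 1}$, and its left adjoint. For $X$ an $n$-track category and $s\ge 0$ put $\mathcal{K}_sX=\mathcal{K}^{s+1}X$, with face maps $\partial_i=\mathcal{K}^i\varepsilon\mathcal{K}^{s-i}:\mathcal{K}_{s}X\to\mathcal{K}_{s-1}X$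 (for $s\ge 1$), degeneracy maps $\sigma_i=\mathcal{K}^i\delta\mathcal{K}^{s-i}:\mathcal{K}_{s}X\to\mathcal{K}_{s+1}X$ $(0\le i\le s)$, and iterated face map $d_I:\mathcal{K}_sX\to X$. A module over a track category $Q$ is an abelian group object in the category of track categories over $Q$ with the same category of objects $Q_0$. For a module $M$ over $Q$, let $E^{(n)}(Q,M)\to d^{(n)}Q$ be the Eilenberg--Mac Lane object, the $(n-1)$-fold iterated delooping of $M$ over $Q$: $E^{(1)}(Q,M)=M$, and $E^{(m+1)}(Q,M)$ is the groupoid, in one further direction, with objects $d^{(m)}Q$ and arrows $E^{(m)}(Q,M)$, whose source and target maps are both the projection $E^{(m)}(Q,M)\to d^{(m)}Q$ and whose composition is the addition. It is an abelian group object over $d^{(n)}Q$. Let $X$ be an $n$-track category and let $M$ be a module over $p^{(1)}X$. For $s\ge 0$ let $d_I^*M$ be the pullback of $M\to p^{(1)}X$ along $p^{(1)}d_I:p^{(1)}\mathcal{K}_sX\to p^{(1)}X$, and let $$D^s=\operatorname{Hom}_{/d^{(n)}p^{(1)}\mathcal{K}_sX}\bigl(\mathcal{K}_sX,\;E^{(n)}(p^{(1)}\mathcal{K}_sX,\,d_I^*M)\bigr)$$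 be the set of maps over $d^{(n)}p^{(1)}\mathcal{K}_sX$ (equivalently, of sections over $\mathcal{K}_sX$ of the pullback of $E^{(n)}(p^{(1)}\mathcal{K}_sX,d_I^*M)$ to $\mathcal{K}_sX$). Then $\{D^s\}_{s\ge 0}$ is a cosimplicial abelian group: the group structure on each $D^s$ is the fibrewise addition of $E^{(n)}(p^{(1)}\mathcal{K}_sX,d_I^*M)$, and, after composing elements of $D^s$ with the canonical map $E^{(n)}(p^{(1)}\mathcal{K}_sX,d_I^*M)\to E^{(n)}(p^{(1)}X,M)$, the coface and codegeneracy maps are given by precomposition with the face maps $\partial_i$ and the degeneracy maps $\sigma_i$ of $\mathcal{K}_\bullet X$. -/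

import Mathlib

open CategoryTheory Opposite

universe u v w

/-! ### Categories with a fixed set of objects -/

/-- A category with set of objects `O`. -/
structure CatO (O : Type u) where
  Arr : O → O → Type u
  one : ∀ a, Arr a a
  mul : ∀ {a b c}, Arr a b → Arr b c → Arr a c
  one_mul : ∀ {a b} (f : Arr a b), mul (one a) f = f
  mul_one : ∀ {a b} (f : Arr a b), mul f (one b) = f
  assoc : ∀ {a b c d} (f : Arr a b) (g : Arr b c) (h : Arr c d),
    mul (mul f g) h = mul f (mul g h)

namespace CatO

variable {O : Type u}

/-- A functor which is the identity on the set of objects `O`. -/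
@[ext]
structure Fun (A B : CatO O) where
  app : ∀ {a b}, A.Arr a b → B.Arr a b
  app_one : ∀ a, app (A.one a) = B.one a
  app_mul : ∀ {a b c} (f : A.Arr a b) (g : A.Arr b c), app (A.mul f g) = B.mul (app f) (app g)

/-- The category `Cat_O` of categories with set of objects `O` and functors
which are the identity on objects. -/
instance : Category.{u} (CatO O) where
  Hom A B := Fun A B
  id A := ⟨fun f => f, fun _ => rfl, fun _ _ => rfl⟩
  comp F G := ⟨fun f => G.app (F.app f), fun a => by rw [F.app_one, G.app_one],
    fun f g => by rw [F.app_mul, G.app_mul]⟩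

@[simp] theorem id_app {A : CatO O} {a b : O} (f : A.Arr a b) : Fun.app (𝟙 A) f = f := rfl

@[simp] theorem comp_app {A B C : CatO O} (F : A ⟶ B) (G : B ⟶ C) {a b : O} (f : A.Arr a b) :
    Fun.app (F ≫ G) f = G.app (F.app f) := rfl

theorem hom_ext {A B : CatO O} {F G : A ⟶ B}
    (h : ∀ {a b} (f : A.Arr a b), F.app f = G.app f) : F = G := by
  apply Fun.ext; funext a b f; exact h f

/-- The functor sending a category over `O` to its set of arrows from `a` to `b`. -/
def homF (a b : O) : CatO O ⥤ Type u where
  obj A := A.Arr a b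
  map F := ↾fun f => F.app f

end CatO

theorem CatO.map_id_app {J : Type v} [Category.{w} J] {O : Type u} (F : J ⥤ CatO O) {j : J} {a b : O}
    (x : (F.obj j).Arr a b) : (F.map (𝟙 j)).app x = x := by
  rw [F.map_id]; rfl

theorem CatO.map_comp_app {J : Type v} [Category.{w} J] {O : Type u} (F : J ⥤ CatO O) {j k l : J} {a b : O}
    (f : j ⟶ k) (g : k ⟶ l)
    (x : (F.obj j).Arr a b) : (F.map (f ≫ g)).app x = (F.map g).app ((F.map f).app x) := by
  rw [F.map_comp]; rfl

theorem CatO.naturality_app {J : Type v} [Category.{w} J] {O : Type u} {F G : J ⥤ CatO O}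
    (α : F ⟶ G) {j k : J} {a b : O} (f : j ⟶ k)
    (x : (F.obj j).Arr a b) :
    (α.app k).app ((F.map f).app x) = (G.map f).app ((α.app j).app x) := by
  have := α.naturality f
  exact congrArg (fun t : F.obj j ⟶ G.obj k => t.app x) this

/-! ### Multisimplicial objects -/

/-- The category `(Δᵒᵖ)ⁿ`. -/
def Idx : ℕ → Type
  | 0 => Discrete PUnit.{1}
  | n + 1 => SimplexCategoryᵒᵖ × Idx n

instance Idx.category : ∀ n, SmallCategory (Idx n)
  | 0 => inferInstanceAs (SmallCategory (Discrete PUnit.{1}))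
  | n + 1 =>
    letI := Idx.category n
    inferInstanceAs (Category.{0} (SimplexCategoryᵒᵖ × Idx n))

/-- The multi-index `([1], …, [1])`. -/
def Idx.one : ∀ n, Idx n
  | 0 => ⟨⟨⟩⟩
  | n + 1 => (op (.mk 1), Idx.one n)

/-- Adjoining a first index. -/
def Idx.cons (n : ℕ) : SimplexCategoryᵒᵖ × Idx n ⥤ Idx (n + 1) where
  obj x := x
  map f := f

/-- The first index. -/
def Idx.first (n : ℕ) : Idx (n + 1) ⥤ SimplexCategoryᵒᵖ where
  obj x := x.1
  map f := f.1

/-- All indices but the first. -/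
def Idx.tail (n : ℕ) : Idx (n + 1) ⥤ Idx n where
  obj x := x.2
  map f := f.2

/-- Adjoining a last index. -/
def Idx.snoc : ∀ n, Idx n × SimplexCategoryᵒᵖ ⥤ Idx (n + 1)
  | 0 =>
    { obj x := (x.2, x.1)
      map f := (f.2, f.1) }
  | n + 1 =>
    { obj x := (x.1.1, (Idx.snoc n).obj (x.1.2, x.2))
      map {x y} f := (f.1.1, (Idx.snoc n).map (X := (x.1.2, x.2)) (Y := (y.1.2, y.2)) (f.1.2, f.2))
      map_id x := Prod.ext rfl ((Idx.snoc n).map_id (x.1.2, x.2))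
      map_comp {x y z} f g := Prod.ext rfl
        ((Idx.snoc n).map_comp (X := (x.1.2, x.2)) (Y := (y.1.2, y.2)) (Z := (z.1.2, z.2))
          (f.1.2, f.2) (g.1.2, g.2)) }

/-- An `(n+1)`-fold simplicial object as a simplicial object (along the first index)
in `n`-fold simplicial objects. -/
def slices (n : ℕ) (C : Type v) [Category.{w} C] :
    (Idx (n + 1) ⥤ C) ⥤ (SimplexCategoryᵒᵖ ⥤ Idx n ⥤ C) :=
  (Functor.whiskeringLeft _ _ _).obj (Idx.cons n) ⋙ Functor.curry

/-- An `(n+1)`-fold simplicial object as an `n`-fold simplicial object (along all indices but the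
last one) in simplicial objects. -/
def lines (n : ℕ) (C : Type v) [Category.{w} C] :
    (Idx (n + 1) ⥤ C) ⥤ (Idx n ⥤ SimplexCategoryᵒᵖ ⥤ C) :=
  (Functor.whiskeringLeft _ _ _).obj (Idx.snoc n) ⋙ Functor.curry

/-- The simplicial object obtained by fixing all indices but the first. -/
def column {n : ℕ} {C : Type v} [Category.{w} C] (X : Idx (n + 1) ⥤ C) (j : Idx n) :
    SimplexCategoryᵒᵖ ⥤ C :=
  ((slices n C).obj X).flip.obj j

/-! ### `n`-fold categories and `n`-fold groupoids, through their multinerves -/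

/-- `Y` is the nerve of a category. -/
def IsCatNerve (Y : SimplexCategoryᵒᵖ ⥤ Type u) : Prop :=
  ∃ (D : Type u) (_ : SmallCategory D), Nonempty (Y ≅ nerve D)

/-- `Y` is the nerve of a groupoid. -/
def IsGpdNerve (Y : SimplexCategoryᵒᵖ ⥤ Type u) : Prop :=
  ∃ (D : Type u) (_ : SmallGroupoid D), Nonempty (Y ≅ nerve D)

/-- `Y` is the nerve of an equivalence relation, i.e. of a groupoid having at most one arrow
between two given objects. -/
def IsEqRelNerve (Y : SimplexCategoryᵒᵖ ⥤ Type u) : Prop :=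
  ∃ (D : Type u) (_ : SmallGroupoid D), Quiver.IsThin D ∧ Nonempty (Y ≅ nerve D)

/-- The `n`-fold simplicial set `X` is the multinerve of an `n`-fold category, i.e.
(inductively) of a category internal to `(n-1)`-fold categories. -/
def IsNFoldCat : ∀ n, (Idx n ⥤ Type u) → Prop
  | 0, _ => True
  | n + 1, X => (∀ k, IsNFoldCat n (((slices n _).obj X).obj k)) ∧ ∀ j, IsCatNerve (column X j)

/-- The `n`-fold simplicial set `X` is the multinerve of an `n`-fold groupoid, i.e.
(inductively) of a groupoid internal to `(n-1)`-fold groupoids. -/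
def IsNFoldGpd : ∀ n, (Idx n ⥤ Type u) → Prop
  | 0, _ => True
  | n + 1, X => (∀ k, IsNFoldGpd n (((slices n _).obj X).obj k)) ∧ ∀ j, IsGpdNerve (column X j)

/-! ### Truncation, homotopically discrete and weakly globular `n`-fold groupoids -/

/-- The truncation functor `p⁽ⁿ⁾`: apply `π₀` (for the nerve of a groupoid, the set of isomorphism
classes of objects) along the last index. -/
def trunc (n : ℕ) : (Idx (n + 1) ⥤ Type u) ⥤ (Idx n ⥤ Type u) :=
  lines n _ ⋙ (Functor.whiskeringRight _ _ _).obj SSet.π₀Functor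

/-- Homotopically discrete `n`-fold categories. -/
def IsHomDiscrete : ∀ n, (Idx n ⥤ Type u) → Prop
  | 0, _ => True
  | n + 1, X => IsNFoldCat (n + 1) X ∧ (∀ j, IsEqRelNerve (((lines n _).obj X).obj j)) ∧
      IsHomDiscrete n ((trunc n).obj X)

section Discretization

variable {C : Type v} [Category.{w} C] (P : (SimplexCategoryᵒᵖ ⥤ C) ⥤ C)

/-- The functor `X ↦ p⁽⁰⁾ p⁽¹⁾ ⋯ p⁽ⁿ⁻¹⁾ X`, where `p⁽ⁱ⁾` applies `P` along the last index: here
`(p⁽¹⁾ ⋯ p⁽ⁿ⁻¹⁾ X)ₖ = p⁽⁰⁾ ⋯ p⁽ⁿ⁻²⁾ (Xₖ)`. -/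
def discr : ∀ n, (Idx n ⥤ C) ⥤ C
  | 0 => (evaluation _ _).obj (Idx.one 0)
  | n + 1 => slices n C ⋙ (Functor.whiskeringRight _ _ _).obj (discr n) ⋙ P

variable (η : ∀ (Y : SimplexCategoryᵒᵖ ⥤ C) (k : SimplexCategoryᵒᵖ), Y.obj k ⟶ P.obj Y)

/-- The components of the discretization map, given the maps `Yₖ → P Y`. -/
def discrMap : ∀ n (X : Idx n ⥤ C) (j : Idx n), X.obj j ⟶ (discr P n).obj X
  | 0, X, _ => X.map (Y := Idx.one 0) (Discrete.eqToHom (Subsingleton.elim _ _))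
  | n + 1, X, j =>
    discrMap n (((slices n C).obj X).obj j.1) j.2 ≫
      η (((slices n C) ⋙ (Functor.whiskeringRight _ _ _).obj (discr P n)).obj X) j.1

end Discretization

/-- The map sending a simplex of `Y` to the connected component of its vertices. -/
def toPi0 (Y : SimplexCategoryᵒᵖ ⥤ Type u) (k : SimplexCategoryᵒᵖ) :
    Y.obj k ⟶ SSet.π₀Functor.obj Y :=
  Y.map (SimplexCategory.const (.mk 0) k.unop 0).op ≫ ↾SSet.π₀.mk

/-- The set `Xᵈ` of an `n`-fold simplicial set. -/
abbrev Discr (n : ℕ) (X : Idx n ⥤ Type u) : Type u := (discr SSet.π₀Functor n).obj X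

/-- The discretization map `X → Xᵈ`. -/
def gam (n : ℕ) (X : Idx n ⥤ Type u) (j : Idx n) (x : X.obj j) : Discr n X :=
  discrMap SSet.π₀Functor toPi0 n X j x

theorem discrMap_hom {C : Type v} [Category.{w} C] (P : (SimplexCategoryᵒᵖ ⥤ C) ⥤ C)
    (η : ∀ (Y : SimplexCategoryᵒᵖ ⥤ C) (k : SimplexCategoryᵒᵖ), Y.obj k ⟶ P.obj Y)
    (hη' : ∀ {Y Z : SimplexCategoryᵒᵖ ⥤ C} (α : Y ⟶ Z) (k), α.app k ≫ η Z k = η Y k ≫ P.map α) :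
    ∀ n {X Y : Idx n ⥤ C} (α : X ⟶ Y) (j : Idx n),
      α.app j ≫ discrMap P η n Y j = discrMap P η n X j ≫ (discr P n).map α
  | 0, X, Y, α, j => (α.naturality _).symm
  | n + 1, X, Y, α, j => by
    have h1 := discrMap_hom P η hη' n (((slices n C).map α).app j.1) j.2
    have h2 := hη' (((slices n C) ⋙ (Functor.whiskeringRight _ _ _).obj (discr P n)).map α) j.1
    let FX : SimplexCategoryᵒᵖ ⥤ C :=
      (slices n C ⋙ (Functor.whiskeringRight _ _ _).obj (discr P n)).obj X
    let FY : SimplexCategoryᵒᵖ ⥤ C :=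
      (slices n C ⋙ (Functor.whiskeringRight _ _ _).obj (discr P n)).obj Y
    have h3 : (α.app j ≫ discrMap P η n (((slices n C).obj Y).obj j.1) j.2 : X.obj j ⟶ FY.obj j.1)
        ≫ η FY j.1 = _ := congrArg (fun t : X.obj j ⟶ FY.obj j.1 => t ≫ η FY j.1) h1
    have h4 : (discrMap P η n (((slices n C).obj X).obj j.1) j.2 : X.obj j ⟶ FX.obj j.1) ≫ _ = _ :=
      congrArg (fun t => (discrMap P η n (((slices n C).obj X).obj j.1) j.2 :
        X.obj j ⟶ FX.obj j.1) ≫ t) h2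
    exact (Category.assoc (Z := P.obj FY) _ _ _).symm.trans (h3.trans
      ((Category.assoc (Z := P.obj FY) _ _ _).trans
        (h4.trans (Category.assoc (Z := P.obj FY) _ _ _).symm)))

theorem discrMap_naturality {C : Type v} [Category.{w} C] (P : (SimplexCategoryᵒᵖ ⥤ C) ⥤ C)
    (η : ∀ (Y : SimplexCategoryᵒᵖ ⥤ C) (k : SimplexCategoryᵒᵖ), Y.obj k ⟶ P.obj Y)
    (hη : ∀ (Y : SimplexCategoryᵒᵖ ⥤ C) {k l} (f : k ⟶ l), Y.map f ≫ η Y l = η Y k)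
    (hη' : ∀ {Y Z : SimplexCategoryᵒᵖ ⥤ C} (α : Y ⟶ Z) (k), α.app k ≫ η Z k = η Y k ≫ P.map α) :
    ∀ n (X : Idx n ⥤ C) {j k : Idx n} (f : j ⟶ k),
      X.map f ≫ discrMap P η n X k = discrMap P η n X j
  | 0, X, j, k, f => (X.map_comp _ _).symm.trans (congrArg X.map (Subsingleton.elim (α := ULift (PLift _)) _ _))
  | n + 1, X, j, k, f => by
    let S := (slices n C).obj X
    have e : X.map f = (S.obj j.1).map f.2 ≫ (S.map f.1).app k.2 := by
      refine Eq.trans ?_ (X.map_comp (X := (j.1, j.2)) (Y := (j.1, k.2)) (Z := (k.1, k.2))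
        (𝟙 j.1, f.2) (f.1, 𝟙 k.2))
      congr 1
      exact Prod.ext (Category.id_comp _).symm (Category.comp_id _).symm
    have h1 := discrMap_hom P η hη' n (S.map f.1) k.2
    have h2 := discrMap_naturality P η hη hη' n (S.obj j.1) f.2
    have h3 := hη (((slices n C) ⋙ (Functor.whiskeringRight _ _ _).obj (discr P n)).obj X) f.1
    let FX : SimplexCategoryᵒᵖ ⥤ C :=
      (slices n C ⋙ (Functor.whiskeringRight _ _ _).obj (discr P n)).obj X
    have h4 : ((S.map f.1).app k.2 ≫ discrMap P η n (S.obj k.1) k.2 :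
        (S.obj j.1).obj k.2 ⟶ FX.obj k.1) ≫ η FX k.1 = _ :=
      congrArg (fun t : (S.obj j.1).obj k.2 ⟶ FX.obj k.1 => t ≫ η FX k.1) h1
    have h5 : (discrMap P η n (S.obj j.1) k.2 : (S.obj j.1).obj k.2 ⟶ FX.obj j.1) ≫ _ = _ :=
      congrArg (fun t : FX.obj j.1 ⟶ P.obj FX =>
        (discrMap P η n (S.obj j.1) k.2 : (S.obj j.1).obj k.2 ⟶ FX.obj j.1) ≫ t) h3
    have h6 : (S.map f.1).app k.2 ≫ (discrMap P η n (S.obj k.1) k.2 ≫ η FX k.1) =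
        discrMap P η n (S.obj j.1) k.2 ≫ η FX j.1 :=
      (Category.assoc (Z := P.obj FX) _ _ _).symm.trans
        (h4.trans ((Category.assoc (Z := P.obj FX) _ _ _).trans h5))
    have h7 : (S.obj j.1).map f.2 ≫ (discrMap P η n (S.obj j.1) k.2 ≫ η FX j.1) =
        discrMap P η n (S.obj j.1) j.2 ≫ η FX j.1 :=
      (Category.assoc (Z := P.obj FX) _ _ _).symm.trans
        (congrArg (fun t : (S.obj j.1).obj j.2 ⟶ FX.obj j.1 => t ≫ η FX j.1) h2)
    rw [e]
    exact (Category.assoc (Z := P.obj FX) _ _ _).trans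
      ((congrArg (fun t : (S.obj j.1).obj k.2 ⟶ P.obj FX => (S.obj j.1).map f.2 ≫ t) h6).trans h7)

theorem toPi0_map (Y : SimplexCategoryᵒᵖ ⥤ Type u) {k l : SimplexCategoryᵒᵖ} (f : k ⟶ l) :
    Y.map f ≫ toPi0 Y l = toPi0 Y k := by
  let i : Fin (k.unop.len + 1) := f.unop.toOrderHom 0
  let e : SimplexCategory.mk 1 ⟶ k.unop := SimplexCategory.mkHom
    ⟨![0, i], by
      intro a b h
      fin_cases a <;> fin_cases b <;> simp_all⟩
  ext x
  have h0 : SimplexCategory.δ (1 : Fin 2) ≫ e = SimplexCategory.const (.mk 0) k.unop 0 := by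
    ext a; fin_cases a; rfl
  have h1 : SimplexCategory.δ (0 : Fin 2) ≫ e =
      SimplexCategory.const (.mk 0) l.unop 0 ≫ f.unop := by
    ext a; fin_cases a; rfl
  have := SSet.π₀.sound (SSet.Edge.mk' (X := Y) (Y.map e.op x))
  have g0 : Y.map (SimplexCategory.δ (1 : Fin 2)).op (Y.map e.op x) =
      Y.map (SimplexCategory.const (.mk 0) k.unop 0).op x := by
    rw [← h0, op_comp, Y.map_comp]; rfl
  have g1 : Y.map (SimplexCategory.δ (0 : Fin 2)).op (Y.map e.op x) =
      Y.map (SimplexCategory.const (.mk 0) l.unop 0).op (Y.map f x) := by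
    have : Y.map (SimplexCategory.δ (0 : Fin 2)).op (Y.map e.op x) =
      Y.map (SimplexCategory.δ (0 : Fin 2) ≫ e).op x := by rw [op_comp, Y.map_comp]; rfl
    rw [this, h1, op_comp, Y.map_comp]; rfl
  exact (congrArg SSet.π₀.mk g1.symm).trans (this.symm.trans (congrArg SSet.π₀.mk g0))

theorem toPi0_hom {Y Z : SimplexCategoryᵒᵖ ⥤ Type u} (α : Y ⟶ Z) (k : SimplexCategoryᵒᵖ) :
    α.app k ≫ toPi0 Z k = toPi0 Y k ≫ SSet.π₀Functor.map α := by
  ext x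
  exact congrArg SSet.π₀.mk
    (ConcreteCategory.congr_hom (α.naturality (SimplexCategory.const (.mk 0) k.unop 0).op) x).symm

theorem gam_map {n : ℕ} (X : Idx n ⥤ Type u) {j k : Idx n} (f : j ⟶ k) (x : X.obj j) :
    gam n X k (X.map f x) = gam n X j x :=
  ConcreteCategory.congr_hom (discrMap_naturality _ _ toPi0_map toPi0_hom n X f) x

theorem gam_hom {n : ℕ} {X Y : Idx n ⥤ Type u} (α : X ⟶ Y) (j : Idx n) (x : X.obj j) :
    gam n Y j (α.app j x) = (discr SSet.π₀Functor n).map α (gam n X j x) :=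
  ConcreteCategory.congr_hom (discrMap_hom _ _ toPi0_hom n α j) x

/-! ### Hom-objects, `n`-equivalences and weakly globular `n`-fold groupoids -/

section Equivalences

variable {n : ℕ}

/-- The `n`-fold simplicial set `Xₖ`. -/
abbrev lev (X : Idx (n + 1) ⥤ Type u) (k : ℕ) : Idx n ⥤ Type u :=
  ((slices n _).obj X).obj (op (.mk k))

/-- The map `Xₖ → Yₖ` induced by `f : X → Y`. -/
abbrev levMap {X Y : Idx (n + 1) ⥤ Type u} (f : X ⟶ Y) (k : ℕ) : lev X k ⟶ lev Y k :=
  ((slices n _).map f).app (op (.mk k))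

/-- The simplicial operators of the simplicial object `k ↦ Xₖ`. -/
abbrev levOp (X : Idx (n + 1) ⥤ Type u) {k l : ℕ}
    (θ : SimplexCategory.mk k ⟶ SimplexCategory.mk l) : lev X l ⟶ lev X k :=
  ((slices n _).obj X).map θ.op

theorem levOp_levMap {X Y : Idx (n + 1) ⥤ Type u} (f : X ⟶ Y) {k l : ℕ}
    (θ : SimplexCategory.mk k ⟶ SimplexCategory.mk l) {j : Idx n} (x : (lev X l).obj j) :
    (levOp Y θ).app j ((levMap f l).app j x) = (levMap f k).app j ((levOp X θ).app j x) :=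
  ConcreteCategory.congr_hom
    (congrArg (fun t => NatTrans.app t j) (((slices n _).map f).naturality θ.op)).symm x

/-- The class in `X₀ᵈ` of the source (`i = 1`) or the target (`i = 0`) of a simplex of `X₁`. -/
def endpt (X : Idx (n + 1) ⥤ Type u) (i : Fin 2) {j : Idx n} (x : (lev X 1).obj j) :
    Discr n (lev X 0) :=
  gam n (lev X 0) j ((levOp X (SimplexCategory.δ i)).app j x)

theorem endpt_map (X : Idx (n + 1) ⥤ Type u) (i : Fin 2) {j k : Idx n} (f : j ⟶ k)
    (x : (lev X 1).obj j) : endpt X i ((lev X 1).map f x) = endpt X i x := by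
  have := ConcreteCategory.congr_hom ((levOp X (SimplexCategory.δ i)).naturality f) x
  exact (congrArg _ this).trans (gam_map _ f _)

theorem endpt_hom {X Y : Idx (n + 1) ⥤ Type u} (f : X ⟶ Y) (i : Fin 2) {j : Idx n}
    (x : (lev X 1).obj j) :
    endpt Y i ((levMap f 1).app j x) =
      (discr SSet.π₀Functor n).map (levMap f 0) (endpt X i x) :=
  (congrArg _ (levOp_levMap f _ x)).trans (gam_hom _ _ _)

/-- The hom-object `X(a, b)`: the fibre over `(a, b)` of `X₁ → X₀ × X₀ → X₀ᵈ × X₀ᵈ`. -/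
def homObj (X : Idx (n + 1) ⥤ Type u) (a b : Discr n (lev X 0)) : Idx n ⥤ Type u where
  obj j := {x : (lev X 1).obj j // endpt X 1 x = a ∧ endpt X 0 x = b}
  map f := ↾fun x => ⟨(lev X 1).map f x.1, by rw [endpt_map, endpt_map]; exact x.2⟩
  map_id j := ConcreteCategory.hom_ext _ _ fun x => Subtype.ext
    (ConcreteCategory.congr_hom ((lev X 1).map_id j) x.1)
  map_comp f g := ConcreteCategory.hom_ext _ _ fun x => Subtype.ext
    (ConcreteCategory.congr_hom ((lev X 1).map_comp f g) x.1)

/-- The map `f(a, b) : X(a, b) → Y(f a, f b)`. -/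
def homObjMap {X Y : Idx (n + 1) ⥤ Type u} (f : X ⟶ Y) (a b : Discr n (lev X 0)) :
    homObj X a b ⟶ homObj Y ((discr SSet.π₀Functor n).map (levMap f 0) a)
      ((discr SSet.π₀Functor n).map (levMap f 0) b) where
  app j := ↾fun x => ⟨(levMap f 1).app j x.1, by
    rw [endpt_hom, endpt_hom, x.2.1, x.2.2]; exact ⟨rfl, rfl⟩⟩
  naturality j k g := by
    refine ConcreteCategory.hom_ext _ _ fun x => Subtype.ext ?_
    exact ConcreteCategory.congr_hom ((levMap f 1).naturality g) x.1

/-- The iterated fibre product `X₁ ×_{X₀ᵈ} ⋯ ×_{X₀ᵈ} X₁` (`k` factors). -/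
def segalObj (X : Idx (n + 1) ⥤ Type u) (k : ℕ) : Idx n ⥤ Type u where
  obj j := {x : Fin k → (lev X 1).obj j //
    ∀ i i' : Fin k, i.val + 1 = i'.val → endpt X 0 (x i) = endpt X 1 (x i')}
  map f := ↾fun x => ⟨fun i => (lev X 1).map f (x.1 i), fun i i' h => by
    rw [endpt_map, endpt_map]; exact x.2 i i' h⟩
  map_id j := ConcreteCategory.hom_ext _ _ fun x => Subtype.ext
    (funext fun i => ConcreteCategory.congr_hom ((lev X 1).map_id j) (x.1 i))
  map_comp f g := ConcreteCategory.hom_ext _ _ fun x => Subtype.ext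
    (funext fun i => ConcreteCategory.congr_hom ((lev X 1).map_comp f g) (x.1 i))

theorem endpt_levOp (X : Idx (n + 1) ⥤ Type u) {k : ℕ} (i i' : Fin k) (h : i.val + 1 = i'.val)
    {j : Idx n} (x : (lev X k).obj j) :
    endpt X 0 ((levOp X (SimplexCategory.mkOfSucc i)).app j x) =
      endpt X 1 ((levOp X (SimplexCategory.mkOfSucc i')).app j x) := by
  have key : SimplexCategory.δ (0 : Fin 2) ≫ SimplexCategory.mkOfSucc i =
      SimplexCategory.δ (1 : Fin 2) ≫ SimplexCategory.mkOfSucc i' := by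
    ext a
    fin_cases a
    exact h
  have h1 : ∀ (t : Fin 2) (i : Fin k), (levOp X (SimplexCategory.δ t)).app j
      ((levOp X (SimplexCategory.mkOfSucc i)).app j x) =
      (levOp X (SimplexCategory.δ t ≫ SimplexCategory.mkOfSucc i)).app j x := fun t i => by
    unfold levOp
    rw [op_comp, Functor.map_comp]; rfl
  unfold endpt
  rw [h1, h1, key]

/-- The induced Segal map `Xₖ → X₁ ×_{X₀ᵈ} ⋯ ×_{X₀ᵈ} X₁`. -/
def segalMap (X : Idx (n + 1) ⥤ Type u) (k : ℕ) : lev X k ⟶ segalObj X k where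
  app j := ↾fun x => ⟨fun i => (levOp X (SimplexCategory.mkOfSucc i)).app j x,
    fun i i' h => endpt_levOp X i i' h x⟩
  naturality j l g := by
    ext x
    refine Subtype.ext (funext fun i => ?_)
    exact ConcreteCategory.congr_hom ((levOp X (SimplexCategory.mkOfSucc i)).naturality g) x

end Equivalences

/-- `n`-equivalences. -/
def IsNEquiv : ∀ n {X Y : Idx n ⥤ Type u}, (X ⟶ Y) → Prop
  | 0, _, _, f => Function.Bijective (f.app (Idx.one 0))
  | n + 1, X, _, f => (∀ a b : Discr n (lev X 0), IsNEquiv n (homObjMap f a b)) ∧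
      IsNEquiv n ((trunc n).map f)

/-- Groupoidal weakly globular `n`-fold categories. -/
def IsGCatWG : ∀ n, (Idx n ⥤ Type u) → Prop
  | 0, _ => True
  | 1, X => IsNFoldGpd 1 X
  | n + 2, X => IsNFoldCat (n + 2) X ∧ (∀ k, IsGCatWG (n + 1) (lev X k)) ∧
      IsHomDiscrete (n + 1) (lev X 0) ∧ (∀ k, 2 ≤ k → IsNEquiv (n + 1) (segalMap X k)) ∧
      IsGCatWG (n + 1) ((trunc (n + 1)).obj X)

/-- Weakly globular `n`-fold groupoids. -/
def IsGpdWG (n : ℕ) (X : Idx n ⥤ Type u) : Prop := IsGCatWG n X ∧ IsNFoldGpd n X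

/-! ### `n`-track categories -/

/-- The `n`-fold simplicial set of arrows from `a` to `b`. -/
abbrev homSet {O : Type u} {n : ℕ} (X : Idx n ⥤ CatO O) (a b : O) : Idx n ⥤ Type u :=
  X ⋙ CatO.homF a b

/-- The category of `n`-track categories with set of objects `O`: categories enriched in weakly
globular `n`-fold groupoids. -/
abbrev NTrack (n : ℕ) (O : Type u) : Type (u + 1) :=
  ObjectProperty.FullSubcategory
    (fun X : Idx n ⥤ CatO O => ∀ a b, IsGpdWG n (homSet X a b))

/-! ### The truncation `p⁽¹⁾` of a multisimplicial object in `Cat_O` -/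

section P1

variable {O : Type u}

theorem CatO.face_degen (Y : SimplexCategoryᵒᵖ ⥤ CatO O) {a b : O} (i : Fin 2)
    (f : (Y.obj (op (.mk 0))).Arr a b) :
    (Y.map (SimplexCategory.δ i).op).app ((Y.map (SimplexCategory.σ (0 : Fin 1)).op).app f) = f := by
  rw [← CatO.map_comp_app, ← op_comp]
  have : SimplexCategory.δ i ≫ SimplexCategory.σ (0 : Fin 1) = 𝟙 (SimplexCategory.mk 0) := by
    ext a
    have := Fin.fin_one_eq_zero a
    subst this
    fin_cases i <;> rfl
  rw [this, op_id, CatO.map_id_app]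

/-- The composition on connected components. -/
def pi0Mul (Y : SimplexCategoryᵒᵖ ⥤ CatO O) {a b c : O}
    (p : SSet.π₀ (Y ⋙ CatO.homF a b)) (q : SSet.π₀ (Y ⋙ CatO.homF b c)) :
    SSet.π₀ (Y ⋙ CatO.homF a c) :=
  SSet.π₀.lift (X := Y ⋙ CatO.homF a b)
    (fun f => SSet.π₀.lift (X := Y ⋙ CatO.homF b c)
      (fun g => SSet.π₀.mk (X := Y ⋙ CatO.homF a c) ((Y.obj (op (.mk 0))).mul f g))
      (fun g g' e => SSet.π₀.sound (X := Y ⋙ CatO.homF a c)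
        { edge := (Y.obj (op (.mk 1))).mul
            ((Y.map (SimplexCategory.σ (0 : Fin 1)).op).app f) e.edge
          src_eq := ((Y.map (SimplexCategory.δ (1 : Fin 2)).op).app_mul _ _).trans
            (congrArg₂ _ (CatO.face_degen Y 1 f) e.src_eq)
          tgt_eq := ((Y.map (SimplexCategory.δ (0 : Fin 2)).op).app_mul _ _).trans
            (congrArg₂ _ (CatO.face_degen Y 0 f) e.tgt_eq) })
      q)
    (fun f f' e => by
      induction q with | mk g
      exact SSet.π₀.sound (X := Y ⋙ CatO.homF a c)
        { edge := (Y.obj (op (.mk 1))).mul e.edge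
            ((Y.map (SimplexCategory.σ (0 : Fin 1)).op).app g)
          src_eq := ((Y.map (SimplexCategory.δ (1 : Fin 2)).op).app_mul _ _).trans
            (congrArg₂ _ e.src_eq (CatO.face_degen Y 1 g))
          tgt_eq := ((Y.map (SimplexCategory.δ (0 : Fin 2)).op).app_mul _ _).trans
            (congrArg₂ _ e.tgt_eq (CatO.face_degen Y 0 g)) })
    p

/-- The functor `p : Gpd(Cat_O) → Cat_O` (isomorphism classes of objects, arrow-wise), defined
on all simplicial objects of `Cat_O` by taking connected components arrow-wise. -/
def catPi0 : (SimplexCategoryᵒᵖ ⥤ CatO O) ⥤ CatO O where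
  obj Y :=
    { Arr a b := SSet.π₀ (Y ⋙ CatO.homF a b)
      one a := SSet.π₀.mk (X := Y ⋙ CatO.homF a a) ((Y.obj (op (.mk 0))).one a)
      mul p q := pi0Mul Y p q
      one_mul {a b} p := by
        induction p with | mk f
        exact congrArg (SSet.π₀.mk (X := Y ⋙ CatO.homF a b)) ((Y.obj (op (.mk 0))).one_mul f)
      mul_one {a b} p := by
        induction p with | mk f
        exact congrArg (SSet.π₀.mk (X := Y ⋙ CatO.homF a b)) ((Y.obj (op (.mk 0))).mul_one f)
      assoc {a b c d} p q r := by
        induction p with | mk f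
        induction q with | mk g
        induction r with | mk h
        exact congrArg (SSet.π₀.mk (X := Y ⋙ CatO.homF a d)) ((Y.obj (op (.mk 0))).assoc f g h) }
  map {Y Z} α :=
    { app {a b} p := SSet.mapπ₀ (X := Y ⋙ CatO.homF a b) (Y := Z ⋙ CatO.homF a b)
        (Functor.whiskerRight α (CatO.homF a b)) p
      app_one a := congrArg (SSet.π₀.mk (X := Z ⋙ CatO.homF a a))
        ((α.app (op (.mk 0))).app_one a)
      app_mul {a b c} p q := by
        obtain ⟨f, rfl⟩ := SSet.π₀.mk_surjective (X := Y ⋙ CatO.homF a b) p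
        obtain ⟨g, rfl⟩ := SSet.π₀.mk_surjective (X := Y ⋙ CatO.homF b c) q
        exact congrArg (SSet.π₀.mk (X := Z ⋙ CatO.homF a c))
          ((α.app (op (.mk 0))).app_mul f g) }
  map_id Y := CatO.hom_ext fun {a b} p => SSet.mapπ₀_id_apply (X := Y ⋙ CatO.homF a b) p
  map_comp {Y Z W} α β := CatO.hom_ext fun {a b} p =>
    SSet.mapπ₀_comp_apply (X := Y ⋙ CatO.homF a b) (Y := Z ⋙ CatO.homF a b)
      (Z := W ⋙ CatO.homF a b)
      (Functor.whiskerRight α (CatO.homF a b)) (Functor.whiskerRight β (CatO.homF a b)) p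

/-- The quotient maps `Yₖ → p Y` (take any vertex, then its connected component). -/
def toCatPi0 (Y : SimplexCategoryᵒᵖ ⥤ CatO O) (k : SimplexCategoryᵒᵖ) :
    Y.obj k ⟶ catPi0.obj Y where
  app {a b} x := toPi0 (Y ⋙ CatO.homF a b) k x
  app_one a := congrArg (SSet.π₀.mk (X := Y ⋙ CatO.homF a a))
    ((Y.map (SimplexCategory.const (.mk 0) k.unop 0).op).app_one a)
  app_mul {a _ c} f g := congrArg (SSet.π₀.mk (X := Y ⋙ CatO.homF a c))
    ((Y.map (SimplexCategory.const (.mk 0) k.unop 0).op).app_mul f g)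

theorem toCatPi0_map (Y : SimplexCategoryᵒᵖ ⥤ CatO O) {k l : SimplexCategoryᵒᵖ} (f : k ⟶ l) :
    Y.map f ≫ toCatPi0 Y l = toCatPi0 Y k :=
  CatO.hom_ext fun {a b} x => ConcreteCategory.congr_hom (toPi0_map (Y ⋙ CatO.homF a b) f) x

theorem toCatPi0_hom {Y Z : SimplexCategoryᵒᵖ ⥤ CatO O} (α : Y ⟶ Z) (k : SimplexCategoryᵒᵖ) :
    α.app k ≫ toCatPi0 Z k = toCatPi0 Y k ≫ catPi0.map α :=
  CatO.hom_ext fun {a b} x =>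
    ConcreteCategory.congr_hom (toPi0_hom (Functor.whiskerRight α (CatO.homF a b)) k) x

/-- The iterated truncation `p⁽¹⁾ = p⁽¹⁾ p⁽²⁾ ⋯ p⁽ⁿ⁾` from `(n+1)`-fold simplicial objects to
simplicial objects in `Cat_O`: `(p⁽¹⁾X)ₖ = p⁽⁰⁾ p⁽¹⁾ ⋯ p⁽ⁿ⁻¹⁾ (Xₖ)`. -/
def pOne (n : ℕ) (O : Type u) : (Idx (n + 1) ⥤ CatO O) ⥤ (SimplexCategoryᵒᵖ ⥤ CatO O) :=
  slices n _ ⋙ (Functor.whiskeringRight _ _ _).obj (discr catPi0 n)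

/-- The functor `d⁽ⁿ⁾` regarding a simplicial object as an `(n+1)`-fold simplicial object which is
constant in all directions but the first. -/
def dsc (n : ℕ) (O : Type u) : (SimplexCategoryᵒᵖ ⥤ CatO O) ⥤ (Idx (n + 1) ⥤ CatO O) :=
  (Functor.whiskeringLeft _ _ _).obj (Idx.first n)

/-- The canonical map `X → d⁽ⁿ⁾ p⁽¹⁾ X`. -/
def toPOne (n : ℕ) (X : Idx (n + 1) ⥤ CatO O) : X ⟶ (dsc n O).obj ((pOne n O).obj X) where
  app k := discrMap catPi0 toCatPi0 n (((slices n _).obj X).obj k.1) k.2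
  naturality j k f := by
    let S := (slices n (CatO O)).obj X
    have e : X.map f = (S.obj j.1).map f.2 ≫ (S.map f.1).app k.2 := by
      refine Eq.trans ?_ (X.map_comp (X := (j.1, j.2)) (Y := (j.1, k.2)) (Z := (k.1, k.2))
        (𝟙 j.1, f.2) (f.1, 𝟙 k.2))
      congr 1
      exact Prod.ext (Category.id_comp _).symm (Category.comp_id _).symm
    have h1 := discrMap_hom catPi0 toCatPi0 toCatPi0_hom n (S.map f.1) k.2
    have h2 := discrMap_naturality catPi0 toCatPi0 toCatPi0_map toCatPi0_hom n (S.obj j.1) f.2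
    rw [e]
    refine (Category.assoc _ _ _).trans ((congrArg ((S.obj j.1).map f.2 ≫ ·) h1).trans ?_)
    exact (Category.assoc _ _ _).symm.trans
      (congrArg (· ≫ (discr catPi0 n).map (S.map f.1)) h2)

end P1

/-! ### The free-forgetful adjunction and its comonad -/

section Free

variable {O : Type u}

/-- The category of graphs with set of vertices `O`, and maps which are the identity on `O`. -/
structure GphO (O : Type u) where
  Edge : O → O → Type u

instance : Category.{u} (GphO O) where
  Hom G H := ∀ ⦃a b⦄, G.Edge a b → H.Edge a b
  id G := fun _ _ x => x
  comp f g := fun _ _ x => g (f x)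

/-- Paths in a graph. -/
inductive Word (E : O → O → Type u) : O → O → Type u
  | nil (a : O) : Word E a a
  | cons {a b c : O} (e : E a b) (w : Word E b c) : Word E a c

namespace Word

variable {E E' E'' : O → O → Type u}

/-- Concatenation of paths. -/
def append {a b c : O} : Word E a b → Word E b c → Word E a c
  | nil _, v => v
  | cons e w, v => cons e (append w v)

/-- The map on paths induced by a map on edges. -/
def map (f : ∀ {a b}, E a b → E' a b) {a b : O} : Word E a b → Word E' a b
  | nil a => nil a
  | cons e w => cons (f e) (map f w)

theorem append_nil {a b : O} (w : Word E a b) : append w (nil b) = w := by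
  induction w with
  | nil => rfl
  | cons e w ih => exact congrArg (cons e) ih

theorem append_assoc {a b c d : O} (w : Word E a b) (v : Word E b c) (x : Word E c d) :
    append (append w v) x = append w (append v x) := by
  induction w with
  | nil => rfl
  | cons e w ih => exact congrArg (cons e) (ih v)

theorem map_append (f : ∀ {a b}, E a b → E' a b) {a b c : O} (w : Word E a b) (v : Word E b c) :
    map f (append w v) = append (map f w) (map f v) := by
  induction w with
  | nil => rfl
  | cons e w ih => exact congrArg (cons (f e)) (ih v)

theorem map_id {a b : O} (w : Word E a b) : map (fun e => e) w = w := by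
  induction w with
  | nil => rfl
  | cons e w ih => exact congrArg (cons e) ih

theorem map_map (f : ∀ {a b}, E a b → E' a b) (g : ∀ {a b}, E' a b → E'' a b)
    {a b : O} (w : Word E a b) : map g (map f w) = map (fun e => g (f e)) w := by
  induction w with
  | nil => rfl
  | cons e w ih => exact congrArg (cons (g (f e))) ih

/-- The composite of a path of arrows of a category. -/
def eval {A : CatO O} (f : ∀ {a b}, E a b → A.Arr a b) {a b : O} : Word E a b → A.Arr a b
  | nil a => A.one a
  | cons e w => A.mul (f e) (eval f w)

theorem eval_append {A : CatO O} (f : ∀ {a b}, E a b → A.Arr a b) {a b c : O}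
    (w : Word E a b) (v : Word E b c) : eval f (append w v) = A.mul (eval f w) (eval f v) := by
  induction w with
  | nil => exact (A.one_mul _).symm
  | cons e w ih => exact (congrArg (A.mul (f e)) (ih v)).trans (A.assoc _ _ _).symm

end Word

/-- The free category on a graph. -/
def freeCat (E : O → O → Type u) : CatO O where
  Arr := Word E
  one := Word.nil
  mul := Word.append
  one_mul _ := rfl
  mul_one := Word.append_nil
  assoc := Word.append_assoc

/-- The multisimplicial set `I ⊠ ⋯ ⊠ I`, where `I` is the nerve of the groupoid with set of objects
`A` and exactly one arrow between any two of them (whose `k`-simplices are the maps from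
`{0, …, k}` to `A`). -/
def Cell (A : Type v) : ∀ n, Idx n → Type v
  | 0, _ => PUnit
  | n + 1, k => (Fin (k.1.unop.len + 1) → A) × Cell A n k.2

/-- The simplicial operators of `I ⊠ ⋯ ⊠ I`. -/
def Cell.map {A : Type v} : ∀ n {j k : Idx n}, (j ⟶ k) → Cell A n j → Cell A n k
  | 0, _, _, _, _ => ⟨⟩
  | n + 1, _, _, f, t => (t.1 ∘ f.1.unop.toOrderHom, Cell.map n f.2 t.2)

/-- The nondegenerate top-dimensional simplex of `I ⊠ ⋯ ⊠ I`, for `A = {0, 1}`. -/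
def Cell.gen : ∀ n, Cell (Fin 2) n (Idx.one n)
  | 0 => ⟨⟩
  | n + 1 => (id, Cell.gen n)

theorem Cell.map_id {A : Type v} : ∀ n {j : Idx n} (t : Cell A n j), Cell.map n (𝟙 j) t = t
  | 0, _, _ => rfl
  | n + 1, _, t => Prod.ext rfl (Cell.map_id n t.2)

theorem Cell.map_comp {A : Type v} : ∀ n {j k l : Idx n} (f : j ⟶ k) (g : k ⟶ l)
    (t : Cell A n j), Cell.map n (f ≫ g) t = Cell.map n g (Cell.map n f t)
  | 0, _, _, _, _, _, _ => rfl
  | n + 1, _, _, _, f, g, t => Prod.ext rfl (Cell.map_comp n f.2 g.2 t.2)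

/-- The free `n`-fold groupoid in `Cat_O` on a graph `G` placed in multidegree `(1, …, 1)`: in each
multidegree `j` it is the free category on the graph `G × (I ⊠ ⋯ ⊠ I)ⱼ`. -/
def freeMS (n : ℕ) (G : GphO O) : Idx n ⥤ CatO O where
  obj j := freeCat (fun a b => G.Edge a b × Cell (Fin 2) n j)
  map {j k} f :=
    { app {a b} w := Word.map (E := fun a b => G.Edge a b × Cell (Fin 2) n j)
        (E' := fun a b => G.Edge a b × Cell (Fin 2) n k) (fun e => (e.1, Cell.map n f e.2)) w
      app_one _ := rfl
      app_mul w v := Word.map_append _ w v }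
  map_id j := CatO.hom_ext fun w => by
    refine Eq.trans ?_ (Word.map_id w)
    change Word.map _ w = _
    simp only [Cell.map_id]
  map_comp f g := CatO.hom_ext fun w => by
    refine Eq.trans ?_ (Word.map_map _ _ w).symm
    change Word.map _ w = _
    simp only [Cell.map_comp]

end Free

/-- A map from the nerve of the groupoid with two objects and one arrow between any two of them
to a simplicial set. -/
structure IFam (Y : SimplexCategoryᵒᵖ ⥤ Type u) where
  app : ∀ k : SimplexCategoryᵒᵖ, (Fin (k.unop.len + 1) → Fin 2) → Y.obj k
  nat : ∀ {k l : SimplexCategoryᵒᵖ} (f : k ⟶ l) (t : Fin (k.unop.len + 1) → Fin 2),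
    app l (t ∘ f.unop.toOrderHom) = Y.map f (app k t)

/-- Given an arrow `y` of a groupoid and a labelling `t` of vertices by `0` and `1`, the simplex whose
`i`-th vertex is the source (`t i = 0`) or the target (`t i = 1`) of `y`, and all of whose edges are
`y`, its inverse, or identities. -/
def gpdSimplex {D : Type u} [Groupoid.{u} D] (y : Fin 2 ⥤ D) {k : ℕ} (t : Fin k → Fin 2) :
    Fin k ⥤ D where
  obj i := y.obj (t i)
  map {i j} _ := Groupoid.inv (y.map (homOfLE (Fin.zero_le (t i)))) ≫
    y.map (homOfLE (Fin.zero_le (t j)))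
  map_id i := Groupoid.inv_comp _
  map_comp {i j l} _ _ := by simp

theorem gpdSimplex_id {D : Type u} [Groupoid.{u} D] (y : Fin 2 ⥤ D) :
    gpdSimplex y id = y := by
  refine CategoryTheory.Functor.ext (fun _ => rfl) (fun i j f => ?_)
  have : y.map (homOfLE (Fin.zero_le j)) = y.map (homOfLE (Fin.zero_le i)) ≫ y.map f := by
    rw [← y.map_comp]; rfl
  have h : Groupoid.inv (y.map (homOfLE (Fin.zero_le i))) ≫ y.map (homOfLE (Fin.zero_le j)) =
      𝟙 _ ≫ y.map f ≫ 𝟙 _ := by rw [this]; simp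
  exact h

theorem gpdFunctor_ext {D : Type u} [Groupoid.{u} D] {k : ℕ} (F G : Fin (k + 1) ⥤ D)
    (h : ∀ i, ∃ (h0 : F.obj 0 = G.obj 0) (hi : F.obj i = G.obj i),
      F.map (homOfLE (Fin.zero_le i)) =
        eqToHom h0 ≫ G.map (homOfLE (Fin.zero_le i)) ≫ eqToHom hi.symm) : F = G := by
  have ho : ∀ i, F.obj i = G.obj i := fun i => (h i).2.1
  refine CategoryTheory.Functor.ext ho (fun i j f => ?_)
  have e : ∀ H : Fin (k + 1) ⥤ D, H.map f = Groupoid.inv (H.map (homOfLE (Fin.zero_le i))) ≫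
      H.map (homOfLE (Fin.zero_le j)) := fun H => by
    have : H.map (homOfLE (Fin.zero_le j)) = H.map (homOfLE (Fin.zero_le i)) ≫ H.map f := by
      rw [← H.map_comp]; rfl
    rw [this]; simp
  obtain ⟨h0, hi, e1⟩ := h i
  obtain ⟨_, hj, e2⟩ := h j
  rw [e F, e G, e1, e2]
  simp [Groupoid.inv_eq_inv]

theorem gpdEdge {D : Type u} [Groupoid.{u} D] {k : ℕ} (F G : Fin (k + 1) ⥤ D) (i : Fin (k + 1))
    (h : (SimplexCategory.mkOfLe 0 i (Fin.zero_le i)).toOrderHom.monotone.functor ⋙ F =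
      (SimplexCategory.mkOfLe 0 i (Fin.zero_le i)).toOrderHom.monotone.functor ⋙ G) :
    ∃ (h0 : F.obj 0 = G.obj 0) (hi : F.obj i = G.obj i),
      F.map (homOfLE (Fin.zero_le i)) =
        eqToHom h0 ≫ G.map (homOfLE (Fin.zero_le i)) ≫ eqToHom hi.symm := by
  have := CategoryTheory.Functor.congr_hom h (X := (0 : Fin 2)) (Y := (1 : Fin 2)) (homOfLE (Fin.zero_le 1))
  exact ⟨CategoryTheory.Functor.congr_obj h (0 : Fin 2), CategoryTheory.Functor.congr_obj h (1 : Fin 2), this⟩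

theorem edge_label (x : Fin 2) : ∃ f : SimplexCategory.mk 1 ⟶ SimplexCategory.mk 1,
    (![0, x] : Fin 2 → Fin 2) = id ∘ f.toOrderHom :=
  ⟨SimplexCategory.mkHom ⟨![0, x], by
    intro a b h; fin_cases a <;> fin_cases b <;> simp_all⟩, rfl⟩

theorem IFam.exists_unique {Y : SimplexCategoryᵒᵖ ⥤ Type u} (h : IsGpdNerve Y)
    (y : Y.obj (op (.mk 1))) : (∃ τ : IFam Y, τ.app (op (.mk 1)) id = y) ∧
      ∀ τ τ' : IFam Y, τ.app (op (.mk 1)) id = τ'.app (op (.mk 1)) id → τ = τ' := by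
  obtain ⟨D, _, ⟨φ⟩⟩ := h
  have hφ : ∀ {k l} (f : k ⟶ l) x, φ.hom.app l (Y.map f x) = (nerve D).map f (φ.hom.app k x) :=
    fun f x => ConcreteCategory.congr_hom (φ.hom.naturality f) x
  have hφ' : ∀ {k l} (f : k ⟶ l) x, φ.inv.app l ((nerve D).map f x) = Y.map f (φ.inv.app k x) :=
    fun f x => ConcreteCategory.congr_hom (φ.inv.naturality f) x
  have hinv : ∀ k x, φ.inv.app k (φ.hom.app k x) = x := fun k x =>
    ConcreteCategory.congr_hom (φ.hom_inv_id_app k) x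
  constructor
  · refine ⟨⟨fun k t => φ.inv.app k (gpdSimplex (φ.hom.app _ y) t), fun {k l} f t => ?_⟩, ?_⟩
    · exact hφ' f (gpdSimplex (φ.hom.app _ y) t)
    · exact (congrArg (φ.inv.app (op (.mk 1))) (gpdSimplex_id (φ.hom.app _ y))).trans (hinv _ y)
  · intro τ τ' e
    have key : ∀ x : Fin 2, τ.app (op (.mk 1)) ![0, x] = τ'.app (op (.mk 1)) ![0, x] := by
      intro x
      obtain ⟨f, hf⟩ := edge_label x
      rw [hf]
      have h1 := τ.nat f.op (id : Fin 2 → Fin 2)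
      have h2 := τ'.nat f.op (id : Fin 2 → Fin 2)
      exact h1.trans ((congrArg _ e).trans h2.symm)
    have main : ∀ (k : ℕ) (t : Fin (k + 1) → Fin 2), τ.app (op (.mk k)) t = τ'.app (op (.mk k)) t := by
      intro k t
      have hd : t = Fin.cons (α := fun _ => Fin 2) 0 t ∘ (SimplexCategory.δ (0 : Fin (k + 2))).toOrderHom := by
        funext i; rfl
      rw [hd]
      have h1 := τ.nat (k := op (.mk (k + 1))) (l := op (.mk k)) (SimplexCategory.δ (0 : Fin (k + 2))).op (Fin.cons (α := fun _ => Fin 2) 0 t)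
      have h2 := τ'.nat (k := op (.mk (k + 1))) (l := op (.mk k)) (SimplexCategory.δ (0 : Fin (k + 2))).op (Fin.cons (α := fun _ => Fin 2) 0 t)
      refine h1.trans (Eq.trans ?_ h2.symm)
      congr 1
      rw [← hinv _ (τ.app _ _), ← hinv _ (τ'.app _ _)]
      congr 1
      refine gpdFunctor_ext (k := k + 1) _ _ fun i => ?_
      have hl : ∀ i : Fin (k + 2), ∃ x : Fin 2, (Fin.cons (α := fun _ => Fin 2) 0 t :  Fin (k + 2) → Fin 2) ∘
          (SimplexCategory.mkOfLe 0 i (Fin.zero_le i)).toOrderHom = ![0, x] := by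
        intro i
        refine ⟨(Fin.cons (α := fun _ => Fin 2) 0 t : Fin (k + 2) → Fin 2) i, ?_⟩
        funext a; fin_cases a <;> rfl
      obtain ⟨x, hx⟩ := hl i
      have g1 := τ.nat (k := op (.mk (k + 1))) (l := op (.mk 1)) (SimplexCategory.mkOfLe 0 i (Fin.zero_le i)).op (Fin.cons (α := fun _ => Fin 2) 0 t)
      have g2 := τ'.nat (k := op (.mk (k + 1))) (l := op (.mk 1)) (SimplexCategory.mkOfLe 0 i (Fin.zero_le i)).op (Fin.cons (α := fun _ => Fin 2) 0 t)
      have g3 : (nerve D).map (SimplexCategory.mkOfLe 0 i (Fin.zero_le i)).op (φ.hom.app _ (τ.app _ (Fin.cons (α := fun _ => Fin 2) 0 t))) = (nerve D).map (SimplexCategory.mkOfLe 0 i (Fin.zero_le i)).op (φ.hom.app _ (τ'.app _ (Fin.cons (α := fun _ => Fin 2) 0 t))) := by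
        rw [← hφ, ← hφ]
        refine congrArg _ (g1.symm.trans (Eq.trans ?_ g2))
        exact (congrArg (τ.app (op (.mk 1))) hx).trans ((key x).trans (congrArg (τ'.app (op (.mk 1))) hx).symm)
      exact gpdEdge _ _ i g3
    cases τ; cases τ'
    congr 1
    funext k t
    exact main k.unop.len t

/-- A map from `I ⊠ ⋯ ⊠ I` to an `n`-fold simplicial set. -/
structure CFam (n : ℕ) (Y : Idx n ⥤ Type u) where
  app : ∀ j : Idx n, Cell (Fin 2) n j → Y.obj j
  nat : ∀ {j k : Idx n} (f : j ⟶ k) (t : Cell (Fin 2) n j), app k (Cell.map n f t) = Y.map f (app j t)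

theorem CFam.ext' {n : ℕ} {Y : Idx n ⥤ Type u} {τ τ' : CFam n Y}
    (h : ∀ j t, τ.app j t = τ'.app j t) : τ = τ' := by
  cases τ; cases τ'
  congr 1
  funext j t
  exact h j t

/-- The simplicial operators of the first direction. -/
theorem column_map {n : ℕ} (Y : Idx (n + 1) ⥤ Type u) {k l : SimplexCategoryᵒᵖ} {i j : Idx n}
    (f : k ⟶ l) (g : i ⟶ j) (x : Y.obj (k, i)) :
    Y.map (X := (k, i)) (Y := (l, j)) (f, g) x =
      (column Y j).map f (Y.map (X := (k, i)) (Y := (k, j)) (𝟙 k, g) x) := by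
  have : ((f, g) : ((k, i) : Idx (n + 1)) ⟶ ((l, j) : Idx (n + 1))) =
      (show ((k, i) : Idx (n + 1)) ⟶ ((k, j) : Idx (n + 1)) from (𝟙 k, g)) ≫
        (show ((k, j) : Idx (n + 1)) ⟶ ((l, j) : Idx (n + 1)) from (f, 𝟙 j)) :=
    Prod.ext (Category.id_comp _).symm (Category.comp_id _).symm
  refine (congrArg (fun t => Y.map t x) this).trans ?_
  exact ConcreteCategory.congr_hom (Y.map_comp (X := (k, i)) (Y := (k, j)) (Z := (l, j))
    (𝟙 k, g) (f, 𝟙 j)) x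

theorem column_map' {n : ℕ} (Y : Idx (n + 1) ⥤ Type u) {k l : SimplexCategoryᵒᵖ} {i j : Idx n}
    (f : k ⟶ l) (g : i ⟶ j) (x : Y.obj (k, i)) :
    Y.map (X := (k, i)) (Y := (l, j)) (f, g) x =
      Y.map (X := (l, i)) (Y := (l, j)) (𝟙 l, g) ((column Y i).map f x) := by
  have : ((f, g) : ((k, i) : Idx (n + 1)) ⟶ ((l, j) : Idx (n + 1))) =
      (show ((k, i) : Idx (n + 1)) ⟶ ((l, i) : Idx (n + 1)) from (f, 𝟙 i)) ≫
        (show ((l, i) : Idx (n + 1)) ⟶ ((l, j) : Idx (n + 1)) from (𝟙 l, g)) :=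
    Prod.ext (Category.comp_id _).symm (Category.id_comp _).symm
  refine (congrArg (fun t => Y.map t x) this).trans ?_
  exact ConcreteCategory.congr_hom (Y.map_comp (X := (k, i)) (Y := (l, i)) (Z := (l, j))
    (f, 𝟙 i) (𝟙 l, g)) x

theorem CFam.exists_unique : ∀ (n : ℕ) {Y : Idx n ⥤ Type u} (_ : IsNFoldGpd n Y)
    (y : Y.obj (Idx.one n)), (∃ τ : CFam n Y, τ.app _ (Cell.gen n) = y) ∧
      ∀ τ τ' : CFam n Y, τ.app _ (Cell.gen n) = τ'.app _ (Cell.gen n) → τ = τ'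
  | 0, Y, _, y => by
    refine ⟨⟨⟨fun j _ => Y.map (X := Idx.one 0) (Discrete.eqToHom (Subsingleton.elim _ _)) y,
      fun {j k} f t => ?_⟩, ?_⟩, fun τ τ' e => CFam.ext' fun j t => ?_⟩
    · have := ConcreteCategory.congr_hom (Y.map_comp (X := Idx.one 0) (Y := j) (Z := k)
        (Discrete.eqToHom (Subsingleton.elim _ _)) f) y
      exact this
    · exact ConcreteCategory.congr_hom (Y.map_id (Idx.one 0)) y
    · obtain ⟨⟨⟩⟩ := j
      exact e
  | n + 1, Y, h, y => by
    have hc := h.2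
    constructor
    · obtain ⟨σ, hσ⟩ := (CFam.exists_unique n (h.1 (op (.mk 1))) y).1
      choose T hT using fun (j : Idx n) (c : Cell (Fin 2) n j) =>
        (IFam.exists_unique (hc j) (σ.app j c)).1
      refine ⟨⟨fun j t => (T j.2 t.2).app j.1 t.1, fun {j k} f t => ?_⟩, (hT _ _).trans hσ⟩
      have e : T k.2 (Cell.map n f.2 t.2) =
          ⟨fun l s => Y.map (X := (l, j.2)) (Y := (l, k.2)) (𝟙 l, f.2) ((T j.2 t.2).app l s),
            fun {l m} g s => by
              refine (congrArg _ ((T j.2 t.2).nat g s)).trans ?_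
              exact (column_map' Y g f.2 _).symm.trans (column_map Y g f.2 _)⟩ := by
        refine (IFam.exists_unique (hc k.2) (σ.app _ (Cell.map n f.2 t.2))).2 _ _ ?_
        rw [hT, σ.nat]
        exact congrArg _ (hT _ _).symm
      have e2 := (T k.2 (Cell.map n f.2 t.2)).nat f.1 t.1
      refine e2.trans ?_
      rw [e]
      exact (column_map Y f.1 f.2 _).symm
    · intro τ τ' e
      have colF : ∀ (τ : CFam (n + 1) Y) (j : Idx n) (c : Cell (Fin 2) n j), ∃ ρ : IFam (column Y j),
          ∀ k t, ρ.app k t = τ.app (k, j) (t, c) := fun τ j c =>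
        ⟨⟨fun k t => τ.app (k, j) (t, c), fun {k l} f t => by
          have := τ.nat (j := (k, j)) (k := (l, j)) (f, 𝟙 j) (t, c)
          refine Eq.trans ?_ this
          exact congrArg (fun z => τ.app (l, j) (t ∘ f.unop.toOrderHom, z)) (Cell.map_id n c).symm⟩,
          fun _ _ => rfl⟩
      let S : CFam (n + 1) Y → CFam n (lev Y 1) := fun τ =>
        ⟨fun j c => τ.app (op (.mk 1), j) (id, c), fun {j k} f c =>
          τ.nat (j := (op (.mk 1), j)) (k := (op (.mk 1), k)) (𝟙 _, f) (id, c)⟩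
      have hS : S τ = S τ' := (CFam.exists_unique n (h.1 (op (.mk 1))) y).2 _ _ e
      refine CFam.ext' fun j t => ?_
      obtain ⟨ρ, hρ⟩ := colF τ j.2 t.2
      obtain ⟨ρ', hρ'⟩ := colF τ' j.2 t.2
      have : ρ = ρ' := by
        refine (IFam.exists_unique (hc j.2) (ρ.app _ id)).2 _ _ ?_
        rw [hρ, hρ']
        exact congrArg (fun z : CFam n (lev Y 1) => z.app j.2 t.2) hS
      exact (hρ j.1 t.1).symm.trans ((congrArg (fun z => z.app j.1 t.1) this).trans (hρ' j.1 t.1))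

section Adj

variable {O : Type u} (n : ℕ)

theorem freeMS_hom_bijective (G : GphO O) (X : Idx n ⥤ CatO O)
    (hX : ∀ a b, IsNFoldGpd n (homSet X a b)) :
    Function.Bijective (fun (F : freeMS n G ⟶ X) (a b : O) (e : G.Edge a b) =>
      (F.app (Idx.one n)).app
        (Word.cons (E := fun a b => G.Edge a b × Cell (Fin 2) n (Idx.one n)) (e, Cell.gen n)
          (Word.nil b))) := by
  constructor
  · intro F F' h
    let fam : ∀ (_ : freeMS n G ⟶ X) {a b : O} (_ : G.Edge a b), CFam n (homSet X a b) :=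
      fun F {a b} e =>
      { app j c := (F.app j).app
          (Word.cons (E := fun a b => G.Edge a b × Cell (Fin 2) n j) (e, c) (Word.nil b))
        nat {j k} f c := CatO.naturality_app F f
          (Word.cons (E := fun a b => G.Edge a b × Cell (Fin 2) n j) (e, c) (Word.nil b)) }
    have hf : ∀ {a b : O} (e : G.Edge a b), fam F e = fam F' e := fun {a b} e =>
      (CFam.exists_unique n (hX a b) ((fam F e).app _ (Cell.gen n))).2 _ _
        (congrFun (congrFun (congrFun h a) b) e)
    refine NatTrans.ext (funext fun j => CatO.hom_ext fun {a b} w => ?_)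
    change Word (fun a b => G.Edge a b × Cell (Fin 2) n j) a b at w
    induction w with
    | nil a => exact ((F.app j).app_one a).trans ((F'.app j).app_one a).symm
    | @cons a b c e w ih =>
      have h1 := (F.app j).app_mul
        (Word.cons (E := fun a b => G.Edge a b × Cell (Fin 2) n j) e (Word.nil b)) w
      have h2 := (F'.app j).app_mul
        (Word.cons (E := fun a b => G.Edge a b × Cell (Fin 2) n j) e (Word.nil b)) w
      refine h1.trans (Eq.trans ?_ h2.symm)
      exact congrArg₂ _ (congrArg (fun z => CFam.app z j e.2) (hf e.1)) ih
  · intro g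
    choose T hT using fun (a b : O) (e : G.Edge a b) =>
      (CFam.exists_unique n (hX a b) (g a b e)).1
    refine ⟨{ app j :=
                { app {a b} w := Word.eval (E := fun a b => G.Edge a b × Cell (Fin 2) n j)
                    (fun e => (T _ _ e.1).app j e.2) w
                  app_one a := rfl
                  app_mul w v := Word.eval_append _ w v }
              naturality j k f := CatO.hom_ext fun {a b} w => ?_ }, ?_⟩
    · change Word (fun a b => G.Edge a b × Cell (Fin 2) n j) a b at w
      induction w with
      | nil a => exact ((X.map f).app_one a).symm
      | @cons a b c e w ih =>
        refine Eq.trans ?_ ((X.map f).app_mul _ _).symm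
        exact congrArg₂ _ ((T _ _ e.1).nat f e.2) ih
    · funext a b e
      exact ((X.obj (Idx.one n)).mul_one _).trans (hT a b e)

end Adj

/-! ### Coproducts of products of codiscrete groupoids -/

namespace Cell

variable {A : Type v}

/-- Adjoining a simplex in the last direction. -/
def snoc : ∀ n {j : Idx n} {k : SimplexCategoryᵒᵖ}, Cell A n j → (Fin (k.unop.len + 1) → A) →
    Cell A (n + 1) ((Idx.snoc n).obj (j, k))
  | 0, _, _, _, t => (t, ⟨⟩)
  | n + 1, _, _, c, t => (c.1, snoc n c.2 t)

theorem snoc_map : ∀ n {j j' : Idx n} {k k' : SimplexCategoryᵒᵖ} (f : j ⟶ j') (g : k ⟶ k')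
    (c : Cell A n j) (t : Fin (k.unop.len + 1) → A),
    Cell.map (n + 1) ((Idx.snoc n).map (X := (j, k)) (Y := (j', k')) (f, g)) (snoc n c t) =
      snoc n (Cell.map n f c) (t ∘ g.unop.toOrderHom)
  | 0, _, _, _, _, _, _, _, _ => rfl
  | n + 1, _, _, _, _, f, g, c, t => Prod.ext rfl (snoc_map n f.2 g c.2 t)

theorem snoc_bijective : ∀ n (j : Idx n) (k : SimplexCategoryᵒᵖ),
    Function.Bijective (fun p : Cell A n j × (Fin (k.unop.len + 1) → A) => snoc n p.1 p.2)
  | 0, _, _ => ⟨fun p q h => Prod.ext rfl (congrArg Prod.fst h), fun x => ⟨(⟨⟩, x.1), rfl⟩⟩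
  | n + 1, j, k => by
    have ih := snoc_bijective n j.2 k
    constructor
    · rintro ⟨c, t⟩ ⟨c', t'⟩ h
      have h1 := congrArg Prod.fst h
      have h2 : (c.2, t) = (c'.2, t') := @ih.1 (c.2, t) (c'.2, t') (congrArg Prod.snd h)
      have h3 : t = t' := congrArg Prod.snd h2
      exact Prod.ext (Prod.ext h1 (congrArg Prod.fst h2)) h3
    · intro x
      obtain ⟨p, hp⟩ := ih.2 x.2
      exact ⟨((x.1, p.1), p.2), Prod.ext rfl hp⟩

/-- The diagonal cell on a vertex. -/
def diag : ∀ n (j : Idx n), A → Cell A n j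
  | 0, _, _ => ⟨⟩
  | n + 1, j, a => (fun _ => a, diag n j.2 a)

/-- Products of cells. -/
def pi {K : Type w} {B : K → Type v} : ∀ n {j : Idx n}, (∀ l, Cell (B l) n j) →
    Cell (∀ l, B l) n j
  | 0, _, _ => ⟨⟩
  | n + 1, _, c => (fun i l => (c l).1 i, pi n fun l => (c l).2)

/-- The components of a product of cells. -/
def proj {K : Type w} {B : K → Type v} : ∀ n {j : Idx n}, Cell (∀ l, B l) n j →
    ∀ l, Cell (B l) n j
  | 0, _, _, _ => ⟨⟩
  | n + 1, _, c, l => (fun i => c.1 i l, proj n c.2 l)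

theorem proj_pi {K : Type w} {B : K → Type v} : ∀ n {j : Idx n} (c : ∀ l, Cell (B l) n j),
    proj n (pi n c) = c
  | 0, _, _ => rfl
  | n + 1, _, c => funext fun l => Prod.ext rfl (congrFun (proj_pi n fun l => (c l).2) l)

theorem pi_proj {K : Type w} {B : K → Type v} : ∀ n {j : Idx n} (c : Cell (∀ l, B l) n j),
    pi n (proj n c) = c
  | 0, _, _ => rfl
  | n + 1, _, c => Prod.ext rfl (pi_proj n c.2)

theorem proj_map {K : Type w} {B : K → Type v} : ∀ n {j j' : Idx n} (f : j ⟶ j')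
    (c : Cell (∀ l, B l) n j) (l : K), proj n (Cell.map n f c) l = Cell.map n f (proj n c l)
  | 0, _, _, _, _, _ => rfl
  | n + 1, _, _, f, c, l => Prod.ext rfl (proj_map n f.2 c.2 l)

end Cell

/-- An isomorphism of an `n`-fold simplicial set with a coproduct of multisimplicial sets
`I ⊠ ⋯ ⊠ I`. -/
structure BoxData (n : ℕ) (X : Idx n ⥤ Type u) where
  S : Type u
  A : S → Type
  ne : ∀ s, Nonempty (A s)
  φ : ∀ (j : Idx n) (s : S), Cell (A s) n j → X.obj j
  nat : ∀ {j k : Idx n} (f : j ⟶ k) (s : S) (c : Cell (A s) n j),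
    X.map f (φ j s c) = φ k s (Cell.map n f c)
  inj : ∀ (j : Idx n) {s s' : S} {c : Cell (A s) n j} {c' : Cell (A s') n j},
    φ j s c = φ j s' c' → (⟨s, c⟩ : Σ s, Cell (A s) n j) = ⟨s', c'⟩
  surj : ∀ (j : Idx n) (x : X.obj j), ∃ s c, φ j s c = x

namespace BoxData

/-- The box structure of the levels. -/
def level {n : ℕ} {X : Idx (n + 1) ⥤ Type u} (b : BoxData (n + 1) X) (k : SimplexCategoryᵒᵖ) :
    BoxData n (((slices n _).obj X).obj k) where
  S := Σ s, (Fin (k.unop.len + 1) → b.A s)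
  A p := b.A p.1
  ne p := b.ne p.1
  φ j p c := b.φ (k, j) p.1 (p.2, c)
  nat {j j'} f p c := b.nat (j := (k, j)) (k := (k, j')) (𝟙 k, f) p.1 (p.2, c)
  inj j {p p' c c'} h := by
    obtain ⟨s, t⟩ := p
    obtain ⟨s', t'⟩ := p'
    have h1 := b.inj (k, j) h
    obtain ⟨rfl, h2⟩ := Sigma.mk.inj_iff.1 h1
    have h3 := eq_of_heq h2
    obtain rfl : t = t' := congrArg Prod.fst h3
    obtain rfl : c = c' := congrArg Prod.snd h3
    rfl
  surj j x := by
    obtain ⟨s, c, h⟩ := b.surj (k, j) x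
    exact ⟨⟨s, c.1⟩, c.2, h⟩

/-- The codiscrete groupoid on a coproduct of nonempty sets. -/
def Codisc {P : Type u} (B : P → Type) : Type u := Σ p, B p

instance {P : Type u} (B : P → Type) : SmallGroupoid (Codisc B) where
  Hom x y := ULift (PLift (x.1 = y.1))
  id x := ⟨⟨rfl⟩⟩
  comp f g := ⟨⟨f.down.down.trans g.down.down⟩⟩
  inv f := ⟨⟨f.down.down.symm⟩⟩

instance {P : Type u} (B : P → Type) : Quiver.IsThin (Codisc B) := fun _ _ =>
  ⟨fun _ _ => ULift.ext _ _ (Subsingleton.elim _ _)⟩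

theorem isEqRelNerve {P : Type u} {B : P → Type} {Z : SimplexCategoryᵒᵖ ⥤ Type u}
    (ψ : ∀ (k : SimplexCategoryᵒᵖ) (p : P), (Fin (k.unop.len + 1) → B p) → Z.obj k)
    (nat : ∀ {k l : SimplexCategoryᵒᵖ} (f : k ⟶ l) p t,
      Z.map f (ψ k p t) = ψ l p (t ∘ f.unop.toOrderHom))
    (inj : ∀ k {p p' t t'}, ψ k p t = ψ k p' t' →
      (⟨p, t⟩ : Σ p, (Fin (k.unop.len + 1) → B p)) = ⟨p', t'⟩)
    (surj : ∀ k x, ∃ p t, ψ k p t = x) : IsEqRelNerve Z := by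
  have hb : ∀ k, Function.Bijective
      (fun q : Σ p, (Fin (k.unop.len + 1) → B p) => ψ k q.1 q.2) := fun k =>
    ⟨fun q q' h => inj k h, fun x => by obtain ⟨p, t, h⟩ := surj k x; exact ⟨⟨p, t⟩, h⟩⟩
  let e := fun k => Equiv.ofBijective _ (hb k)
  let F : ∀ k, (Σ p, (Fin (k.unop.len + 1) → B p)) → (nerve (Codisc B)).obj k := fun k q =>
    ({ obj := fun i => (⟨q.1, q.2 i⟩ : Codisc B), map := fun _ => ⟨⟨rfl⟩⟩ } :
      Fin (k.unop.len + 1) ⥤ Codisc B)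
  have hF : ∀ k, Function.Bijective (F k) := fun k => by
    constructor
    · rintro ⟨p, t⟩ ⟨p', t'⟩ h
      have h1 : ∀ i, (⟨p, t i⟩ : Codisc B) = ⟨p', t' i⟩ := fun i =>
        CategoryTheory.Functor.congr_obj h i
      have : p = p' := congrArg Sigma.fst (h1 0)
      subst this
      have : t = t' := funext fun i => by simpa using h1 i
      rw [this]
    · intro G
      change Fin (k.unop.len + 1) ⥤ Codisc B at G
      have hG : ∀ i, (G.obj i).1 = (G.obj 0).1 := fun i =>
        (G.map (homOfLE (Fin.zero_le i))).down.down.symm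
      refine ⟨⟨(G.obj 0).1, fun i => cast (congrArg B (hG i)) (G.obj i).2⟩, ?_⟩
      refine CategoryTheory.Functor.ext (fun i => ?_) (fun _ _ _ => Subsingleton.elim _ _)
      exact Sigma.ext (hG i).symm (cast_heq _ _)
  let e2 := fun k => Equiv.ofBijective _ (hF k)
  refine ⟨Codisc B, inferInstance, inferInstance, ⟨Iso.symm (NatIso.ofComponents
    (fun k => ((e2 k).symm.trans (e k)).toIso) ?_)⟩⟩
  intro k l f
  refine ConcreteCategory.hom_ext _ _ fun x => ?_
  obtain ⟨q, rfl⟩ := (e2 k).surjective x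
  have h1 : (nerve (Codisc B)).map f (e2 k q) = e2 l ⟨q.1, q.2 ∘ f.unop.toOrderHom⟩ := rfl
  change (e l) ((e2 l).symm ((nerve (Codisc B)).map f (e2 k q))) =
    Z.map f ((e k) ((e2 k).symm (e2 k q)))
  rw [h1, Equiv.symm_apply_apply, Equiv.symm_apply_apply]
  exact (nat f q.1 q.2).symm

theorem pi0_eq {P : Type u} {B : P → Type} {Z : SimplexCategoryᵒᵖ ⥤ Type u}
    (ψ : ∀ (k : SimplexCategoryᵒᵖ) (p : P), (Fin (k.unop.len + 1) → B p) → Z.obj k)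
    (nat : ∀ {k l : SimplexCategoryᵒᵖ} (f : k ⟶ l) p t,
      Z.map f (ψ k p t) = ψ l p (t ∘ f.unop.toOrderHom))
    (inj : ∀ k {p p' t t'}, ψ k p t = ψ k p' t' →
      (⟨p, t⟩ : Σ p, (Fin (k.unop.len + 1) → B p)) = ⟨p', t'⟩)
    (surj : ∀ k x, ∃ p t, ψ k p t = x) (hB : ∀ p, Nonempty (B p)) :
    ∃ g : P → SSet.π₀Functor.obj Z, Function.Bijective g ∧
      ∀ p t, SSet.π₀.mk (X := Z) (ψ (op (.mk 0)) p t) = g p := by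
  have e1 : ∀ p (t t' : Fin 1 → B p), SSet.π₀.mk (X := Z) (ψ (op (.mk 0)) p t) =
      SSet.π₀.mk (X := Z) (ψ (op (.mk 0)) p t') := fun p t t' => by
    refine SSet.π₀.sound (X := Z) ⟨ψ (op (.mk 1)) p ![t 0, t' 0], ?_, ?_⟩
    · refine (nat (SimplexCategory.δ (1 : Fin 2)).op p _).trans (congrArg (ψ (op (.mk 0)) p) ?_)
      funext i; fin_cases i; rfl
    · refine (nat (SimplexCategory.δ (0 : Fin 2)).op p _).trans (congrArg (ψ (op (.mk 0)) p) ?_)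
      funext i; fin_cases i; rfl
  let g : P → SSet.π₀Functor.obj Z := fun p =>
    SSet.π₀.mk (X := Z) (ψ (op (.mk 0)) p fun _ => (hB p).some)
  have hs : ∀ k x, ∃ p t, ψ k p t = x := surj
  choose r rt hr using fun x => surj (op (.mk 0)) x
  have hr' : ∀ p t, r (ψ (op (.mk 0)) p t) = p := fun p t =>
    congrArg Sigma.fst (inj _ (hr (ψ (op (.mk 0)) p t)))
  let h : SSet.π₀ Z → P := SSet.π₀.lift (X := Z) r (fun x y e => by
    obtain ⟨p, t, ht⟩ := surj (op (.mk 1)) e.edge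
    have h1 := e.src_eq
    have h2 := e.tgt_eq
    rw [← ht] at h1 h2
    have h3 := (nat (SimplexCategory.δ (1 : Fin 2)).op p t).symm.trans h1
    have h4 := (nat (SimplexCategory.δ (0 : Fin 2)).op p t).symm.trans h2
    rw [← h3, ← h4, hr', hr'])
  refine ⟨g, ⟨fun p p' hp => ?_, fun x => ?_⟩, fun p t => e1 _ _ _⟩
  · have := congrArg h hp
    exact (hr' p _).symm.trans (this.trans (hr' p' _))
  · obtain ⟨y, rfl⟩ := SSet.π₀.mk_surjective (X := Z) x
    obtain ⟨p, t, rfl⟩ := surj (op (.mk 0)) y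
    exact ⟨p, e1 _ _ _⟩

variable {n : ℕ} {X : Idx (n + 1) ⥤ Type u}

theorem column_eqRel (b : BoxData (n + 1) X) (j : Idx n) : IsEqRelNerve (column X j) := by
  refine isEqRelNerve (P := Σ s, Cell (b.A s) n j) (B := fun p => b.A p.1)
    (fun k p t => b.φ (k, j) p.1 (t, p.2)) (fun {k l} f p t => ?_) (fun k p p' t t' h => ?_)
    (fun k x => ?_)
  · refine (b.nat (j := (k, j)) (k := (l, j)) (f, 𝟙 j) p.1 (t, p.2)).trans ?_
    exact congrArg (fun z => b.φ (l, j) p.1 (t ∘ f.unop.toOrderHom, z)) (Cell.map_id n p.2)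
  · obtain ⟨s, c⟩ := p
    obtain ⟨s', c'⟩ := p'
    have h1 := b.inj (k, j) h
    obtain ⟨rfl, h2⟩ := Sigma.mk.inj_iff.1 h1
    have h3 := eq_of_heq h2
    obtain rfl : t = t' := congrArg Prod.fst h3
    obtain rfl : c = c' := congrArg Prod.snd h3
    rfl
  · obtain ⟨s, c, h⟩ := b.surj (k, j) x
    exact ⟨⟨s, c.2⟩, c.1, h⟩

variable (b : BoxData (n + 1) X)

/-- The simplices of a line of a box. -/
def lineφ (j : Idx n) (k : SimplexCategoryᵒᵖ) (p : Σ s, Cell (b.A s) n j)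
    (t : Fin (k.unop.len + 1) → b.A p.1) : (((lines n _).obj X).obj j).obj k :=
  b.φ ((Idx.snoc n).obj (j, k)) p.1 (Cell.snoc n p.2 t)

theorem lineφ_nat (j : Idx n) {k l : SimplexCategoryᵒᵖ} (f : k ⟶ l) (p : Σ s, Cell (b.A s) n j)
    (t : Fin (k.unop.len + 1) → b.A p.1) :
    (((lines n _).obj X).obj j).map f (b.lineφ j k p t) =
      b.lineφ j l p (t ∘ f.unop.toOrderHom) := by
  refine (b.nat ((Idx.snoc n).map (X := (j, k)) (Y := (j, l)) (𝟙 j, f)) p.1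
    (Cell.snoc n p.2 t)).trans ?_
  refine congrArg (b.φ _ p.1) ((Cell.snoc_map n (𝟙 j) f p.2 t).trans ?_)
  rw [Cell.map_id]

theorem lineφ_inj (j : Idx n) (k : SimplexCategoryᵒᵖ) {p p' : Σ s, Cell (b.A s) n j}
    {t : Fin (k.unop.len + 1) → b.A p.1} {t' : Fin (k.unop.len + 1) → b.A p'.1}
    (h : b.lineφ j k p t = b.lineφ j k p' t') :
    (⟨p, t⟩ : Σ p : (Σ s, Cell (b.A s) n j), (Fin (k.unop.len + 1) → b.A p.1)) = ⟨p', t'⟩ := by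
  obtain ⟨s, c⟩ := p
  obtain ⟨s', c'⟩ := p'
  have h1 := b.inj _ h
  obtain ⟨rfl, h2⟩ := Sigma.mk.inj_iff.1 h1
  have h3 := @(Cell.snoc_bijective n j k).1 (c, t) (c', t') (eq_of_heq h2)
  obtain rfl : c = c' := congrArg Prod.fst h3
  obtain rfl : t = t' := congrArg Prod.snd h3
  rfl

theorem lineφ_surj (j : Idx n) (k : SimplexCategoryᵒᵖ) (x : (((lines n _).obj X).obj j).obj k) :
    ∃ p t, b.lineφ j k p t = x := by
  obtain ⟨s, c, h⟩ := b.surj _ x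
  obtain ⟨⟨c', t⟩, rfl⟩ := (Cell.snoc_bijective n j k).2 c
  exact ⟨⟨s, c'⟩, t, h⟩

theorem line_eqRel (b : BoxData (n + 1) X) (j : Idx n) : IsEqRelNerve (((lines n _).obj X).obj j) :=
  isEqRelNerve (b.lineφ j) (b.lineφ_nat j) (fun k => b.lineφ_inj j k) (b.lineφ_surj j)

theorem line_pi0 (j : Idx n) : ∃ g : (Σ s, Cell (b.A s) n j) → ((trunc n).obj X).obj j,
    Function.Bijective g ∧
      ∀ p t, SSet.π₀.mk (X := ((lines n _).obj X).obj j) (b.lineφ j (op (.mk 0)) p t) = g p :=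
  pi0_eq (b.lineφ j) (b.lineφ_nat j) (fun k => b.lineφ_inj j k) (b.lineφ_surj j)
    (fun p => b.ne p.1)

/-- The box structure of the truncation. -/
noncomputable def truncation : BoxData n ((trunc n).obj X) where
  S := b.S
  A := b.A
  ne := b.ne
  φ j s c := (b.line_pi0 j).choose ⟨s, c⟩
  nat {j k} f s c := by
    have h1 := (b.line_pi0 j).choose_spec.2 ⟨s, c⟩ (fun _ => (b.ne s).some)
    have h2 := (b.line_pi0 k).choose_spec.2 ⟨s, Cell.map n f c⟩ (fun _ => (b.ne s).some)
    rw [← h1, ← h2]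
    refine congrArg (SSet.π₀.mk (X := ((lines n _).obj X).obj k)) ?_
    refine (b.nat ((Idx.snoc n).map (X := (j, op (.mk 0))) (Y := (k, op (.mk 0)))
      (f, 𝟙 _)) s _).trans ?_
    exact congrArg (b.φ _ s) (Cell.snoc_map n f (𝟙 _) c _)
  inj j {s s' c c'} h := (b.line_pi0 j).choose_spec.1.1 h
  surj j x := by
    obtain ⟨⟨s, c⟩, h⟩ := (b.line_pi0 j).choose_spec.1.2 x
    exact ⟨s, c, h⟩

end BoxData

namespace BoxData

theorem isNFoldGpd : ∀ (n : ℕ) {X : Idx n ⥤ Type u} (_ : BoxData n X), IsNFoldGpd n X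
  | 0, _, _ => trivial
  | n + 1, _, b => ⟨fun k => isNFoldGpd n (b.level k), fun j => by
      obtain ⟨D, i, _, h⟩ := b.column_eqRel j
      exact ⟨D, i, h⟩⟩

theorem isNFoldCat : ∀ (n : ℕ) {X : Idx n ⥤ Type u} (_ : BoxData n X), IsNFoldCat n X
  | 0, _, _ => trivial
  | n + 1, _, b => ⟨fun k => isNFoldCat n (b.level k), fun j => by
      obtain ⟨D, i, _, h⟩ := b.column_eqRel j
      exact ⟨D, inferInstance, h⟩⟩

theorem isHomDiscrete : ∀ (n : ℕ) {X : Idx n ⥤ Type u} (_ : BoxData n X), IsHomDiscrete n X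
  | 0, _, _ => trivial
  | n + 1, _, b => ⟨isNFoldCat _ b, b.line_eqRel, isHomDiscrete n b.truncation⟩

/-- The discretization of a box. -/
theorem exists_cls : ∀ (n : ℕ) {X : Idx n ⥤ Type u} (b : BoxData n X),
    ∃ g : b.S → Discr n X, Function.Bijective g ∧ ∀ j s c, gam n X j (b.φ j s c) = g s
  | 0, X, b => by
    refine ⟨fun s => b.φ (Idx.one 0) s ⟨⟩, ⟨fun s s' h => ?_, fun x => ?_⟩, fun j s c => ?_⟩
    · exact congrArg Sigma.fst (b.inj _ h)
    · obtain ⟨s, c, h⟩ := b.surj (Idx.one 0) x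
      exact ⟨s, h⟩
    · exact b.nat (k := Idx.one 0) (Discrete.eqToHom (Subsingleton.elim _ _)) s c
  | n + 1, X, b => by
    choose g hg using fun k => exists_cls n (b.level k)
    let Z : SimplexCategoryᵒᵖ ⥤ Type u :=
      (slices n _ ⋙ (Functor.whiskeringRight _ _ _).obj (discr SSet.π₀Functor n)).obj X
    have hc : ∀ s (j : Idx n), Nonempty (Cell (b.A s) n j) := fun s j =>
      ⟨Cell.diag n j (b.ne s).some⟩
    obtain ⟨h, hb, hh⟩ := pi0_eq (Z := Z) (P := b.S) (B := b.A) (fun k s t => g k ⟨s, t⟩)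
      (fun {k l} f s t => by
        have h1 := (hg k).2 (Idx.one n) ⟨s, t⟩ (hc s _).some
        have h2 := (hg l).2 (Idx.one n) ⟨s, t ∘ f.unop.toOrderHom⟩ (hc s _).some
        rw [← h1, ← h2]
        refine (gam_hom (((slices n _).obj X).map f) (Idx.one n) _).symm.trans ?_
        refine congrArg _ ((b.nat (j := (k, Idx.one n)) (k := (l, Idx.one n)) (f, 𝟙 _) s
          (t, (hc s _).some)).trans ?_)
        exact congrArg (fun z => b.φ (l, Idx.one n) s (t ∘ f.unop.toOrderHom, z))
          (Cell.map_id n _))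
      (fun k {p p' t t'} h => (hg k).1.1 h)
      (fun k x => by
        obtain ⟨⟨s, t⟩, h⟩ := (hg k).1.2 x
        exact ⟨s, t, h⟩) b.ne
    refine ⟨h, hb, fun j s c => ?_⟩
    have e1 := (hg j.1).2 j.2 ⟨s, c.1⟩ c.2
    have e2 : gam (n + 1) X j (b.φ j s c) = toPi0 Z j.1 (g j.1 ⟨s, c.1⟩) :=
      congrArg (toPi0 Z j.1) e1
    refine e2.trans (Eq.trans ?_ (hh s fun _ => c.1 0))
    refine congrArg (SSet.π₀.mk (X := Z)) ?_
    have h1 := (hg j.1).2 (Idx.one n) ⟨s, c.1⟩ (hc s _).some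
    have h2 := (hg (op (.mk 0))).2 (Idx.one n) ⟨s, fun _ => c.1 0⟩ (hc s _).some
    rw [← h1, ← h2]
    refine (gam_hom (((slices n _).obj X).map
      (SimplexCategory.const (.mk 0) j.1.unop 0).op) (Idx.one n) _).symm.trans ?_
    refine congrArg _ ((b.nat (j := (j.1, Idx.one n)) (k := (op (.mk 0), Idx.one n))
      ((SimplexCategory.const (.mk 0) j.1.unop 0).op, 𝟙 _) s (c.1, (hc s _).some)).trans ?_)
    exact congrArg (fun z => b.φ (op (.mk 0), Idx.one n) s (fun _ => c.1 0, z))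
      (Cell.map_id n _)

/-- The class in the discretization of a point of a box. -/
noncomputable def cls {n : ℕ} {X : Idx n ⥤ Type u} (b : BoxData n X) : b.S → Discr n X :=
  (exists_cls n b).choose

theorem cls_bijective {n : ℕ} {X : Idx n ⥤ Type u} (b : BoxData n X) :
    Function.Bijective b.cls := (exists_cls n b).choose_spec.1

theorem gam_φ {n : ℕ} {X : Idx n ⥤ Type u} (b : BoxData n X) (j : Idx n) (s : b.S)
    (c : Cell (b.A s) n j) : gam n X j (b.φ j s c) = b.cls s := (exists_cls n b).choose_spec.2 j s c

/-- The effect of a map of boxes on the index sets. -/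
theorem exists_map {n : ℕ} {X Y : Idx n ⥤ Type u} (b : BoxData n X) (b' : BoxData n Y)
    (f : X ⟶ Y) : ∃ g : b.S → b'.S, ∀ j s c, ∃ c', f.app j (b.φ j s c) = b'.φ j (g s) c' := by
  have : ∀ s, ∃ s', b'.cls s' = (discr SSet.π₀Functor n).map f (b.cls s) := fun s =>
    b'.cls_bijective.2 _
  choose g hg using this
  refine ⟨g, fun j s c => ?_⟩
  obtain ⟨s', c', h⟩ := b'.surj j (f.app j (b.φ j s c))
  have h2 : b'.cls s' = b'.cls (g s) := by
    rw [hg, ← b.gam_φ j s c, ← gam_hom, ← h, b'.gam_φ]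
  obtain rfl := b'.cls_bijective.1 h2
  exact ⟨c', h.symm⟩

section Homs

variable {n : ℕ} {X : Idx (n + 1) ⥤ Type u} (b : BoxData (n + 1) X)

theorem endpt_φ (i : Fin 2) (j : Idx n) (p : (b.level (op (.mk 1))).S)
    (c : Cell (b.A p.1) n j) : endpt X i ((b.level (op (.mk 1))).φ j p c) =
      (b.level (op (.mk 0))).cls ⟨p.1, fun _ => p.2 (Fin.succAbove i 0)⟩ := by
  rw [← (b.level (op (.mk 0))).gam_φ j ⟨p.1, fun _ => p.2 (Fin.succAbove i 0)⟩ c]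
  refine congrArg (gam n (lev X 0) j) ?_
  refine (b.nat (j := (op (.mk 1), j)) (k := (op (.mk 0), j))
    ((SimplexCategory.δ i).op, 𝟙 _) p.1 (p.2, c)).trans ?_
  refine congrArg (b.φ (op (.mk 0), j) p.1) (Prod.ext ?_ (Cell.map_id n _))
  funext a
  have := Fin.fin_one_eq_zero a
  subst this
  rfl

/-- The box structure of the hom-objects. -/
noncomputable def homBox (x y : Discr n (lev X 0)) : BoxData n (homObj X x y) where
  S := {p : (b.level (op (.mk 1))).S //
    (b.level (op (.mk 0))).cls ⟨p.1, fun _ => p.2 0⟩ = x ∧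
    (b.level (op (.mk 0))).cls ⟨p.1, fun _ => p.2 1⟩ = y}
  A p := b.A p.1.1
  ne p := b.ne p.1.1
  φ j p c := ⟨(b.level (op (.mk 1))).φ j p.1 c,
    (b.endpt_φ 1 j p.1 c).trans p.2.1, (b.endpt_φ 0 j p.1 c).trans p.2.2⟩
  nat f p c := Subtype.ext ((b.level (op (.mk 1))).nat f p.1 c)
  inj j {p p' c c'} h := by
    have h1 := (b.level (op (.mk 1))).inj j (congrArg Subtype.val h)
    obtain ⟨p, hp⟩ := p
    obtain ⟨p', hp'⟩ := p'
    obtain ⟨rfl, h2⟩ := Sigma.mk.inj_iff.1 h1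
    obtain rfl := eq_of_heq h2
    rfl
  surj j z := by
    obtain ⟨p, c, h⟩ := (b.level (op (.mk 1))).surj j z.1
    refine ⟨⟨p, ?_, ?_⟩, c, Subtype.ext h⟩
    · rw [← z.2.1, ← h]; exact (b.endpt_φ 1 j p c).symm
    · rw [← z.2.2, ← h]; exact (b.endpt_φ 0 j p c).symm

theorem homBox_subsingleton (x y : Discr n (lev X 0)) (p q : (b.homBox x y).S) : p = q := by
  obtain ⟨⟨s, t⟩, h0, h1⟩ := p
  obtain ⟨⟨s', t'⟩, h0', h1'⟩ := q
  refine Subtype.ext ?_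
  have e0 := (b.level (op (.mk 0))).cls_bijective.1 (h0.trans h0'.symm)
  have e1 := (b.level (op (.mk 0))).cls_bijective.1 (h1.trans h1'.symm)
  obtain ⟨hs, e0⟩ := Sigma.mk.inj_iff.1 e0
  change s = s' at hs
  subst hs
  obtain ⟨_, e1⟩ := Sigma.mk.inj_iff.1 e1
  have g0 : t 0 = t' 0 := congrFun (eq_of_heq e0) 0
  have g1 : t 1 = t' 1 := congrFun (eq_of_heq e1) 0
  have : t = t' := by
    funext i
    change Fin 2 at i
    fin_cases i
    · exact g0
    · exact g1
  subst this
  rfl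

end Homs

theorem isNEquiv : ∀ (n : ℕ) {X Y : Idx n ⥤ Type u} (b : BoxData n X) (b' : BoxData n Y)
    (f : X ⟶ Y) (g : b.S → b'.S), Function.Bijective g →
    (∀ j s c, ∃ c', f.app j (b.φ j s c) = b'.φ j (g s) c') → IsNEquiv n f
  | 0, X, Y, b, b', f, g, hg, h => by
    refine ⟨fun x y e => ?_, fun y => ?_⟩
    · obtain ⟨s, c, rfl⟩ := b.surj _ x
      obtain ⟨s', c', rfl⟩ := b.surj _ y
      obtain ⟨d, hd⟩ := h _ s c
      obtain ⟨d', hd'⟩ := h _ s' c'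
      have := congrArg Sigma.fst (b'.inj _ (hd.symm.trans (e.trans hd')))
      obtain rfl := hg.1 this
      rfl
    · obtain ⟨s', c', rfl⟩ := b'.surj _ y
      obtain ⟨s, rfl⟩ := hg.2 s'
      obtain ⟨d, hd⟩ := h (Idx.one 0) s ⟨⟩
      exact ⟨_, hd⟩
  | n + 1, X, Y, b, b', f, g, hg, h => by
    refine ⟨fun x y => ?_, ?_⟩
    · obtain ⟨g', hg'⟩ := exists_map (b.homBox x y) (b'.homBox _ _) (homObjMap f x y)
      refine isNEquiv n _ _ _ g' ⟨fun p q _ => b.homBox_subsingleton x y p q, fun q => ?_⟩ hg'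
      obtain ⟨⟨s, t⟩, rfl⟩ := (b.level (op (.mk 0))).cls_bijective.2 x
      obtain ⟨⟨s', t'⟩, rfl⟩ := (b.level (op (.mk 0))).cls_bijective.2 y
      have key : ∀ s t, ∃ t', (discr SSet.π₀Functor n).map (levMap f 0)
          ((b.level (op (.mk 0))).cls ⟨s, t⟩) = (b'.level (op (.mk 0))).cls ⟨g s, t'⟩ := by
        intro s t
        obtain ⟨c', hc'⟩ := h (op (.mk 0), Idx.one n) s
          (t, Cell.diag n (Idx.one n) (b.ne s).some)
        refine ⟨c'.1, ?_⟩
        have := (b.level (op (.mk 0))).gam_φ (Idx.one n) ⟨s, t⟩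
          (Cell.diag n (Idx.one n) (b.ne s).some)
        rw [← this, ← (b'.level (op (.mk 0))).gam_φ (Idx.one n) ⟨g s, c'.1⟩ c'.2, ← gam_hom]
        exact congrArg _ hc'
      obtain ⟨u, hu⟩ := key s t
      obtain ⟨u', hu'⟩ := key s' t'
      obtain ⟨⟨r, v⟩, h0, h1⟩ := q
      have e0 := congrArg Sigma.fst ((b'.level (op (.mk 0))).cls_bijective.1 (h0.trans hu))
      have e1 := congrArg Sigma.fst ((b'.level (op (.mk 0))).cls_bijective.1 (h1.trans hu'))
      obtain rfl : s = s' := hg.1 (e0.symm.trans e1)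
      refine ⟨⟨⟨s, ![t 0, t' 0]⟩, ?_, ?_⟩, b'.homBox_subsingleton _ _ _ _⟩
      · refine congrArg (b.level (op (.mk 0))).cls (congrArg (Sigma.mk s) ?_)
        funext i
        change Fin 1 at i
        fin_cases i
        rfl
      · refine congrArg (b.level (op (.mk 0))).cls (congrArg (Sigma.mk s) ?_)
        funext i
        change Fin 1 at i
        fin_cases i
        rfl
    · refine isNEquiv n b.truncation b'.truncation _ g hg fun j s c => ?_
      have h1 := (b.line_pi0 j).choose_spec.2 ⟨s, c⟩ (fun _ => (b.ne s).some)
      obtain ⟨c', hc'⟩ := h _ s (Cell.snoc n (k := op (.mk 0)) c (fun _ => (b.ne s).some))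
      obtain ⟨⟨d, t⟩, rfl⟩ := (Cell.snoc_bijective n j (op (.mk 0))).2 c'
      refine ⟨d, ?_⟩
      have h2 := (b'.line_pi0 j).choose_spec.2 ⟨g s, d⟩ t
      refine (congrArg (((trunc n).map f).app j) h1.symm).trans (Eq.trans ?_ h2)
      exact congrArg (SSet.π₀.mk (X := ((lines n _).obj Y).obj j)) hc'

end BoxData

namespace BoxData

section Segal

variable {n : ℕ} {X : Idx (n + 1) ⥤ Type u} (b : BoxData (n + 1) X)

/-- The box structure of the iterated fibre products. -/
noncomputable def segBox (k : ℕ) : BoxData n (segalObj X k) where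
  S := {p : Fin k → (b.level (op (.mk 1))).S // ∀ i i' : Fin k, i.val + 1 = i'.val →
    (b.level (op (.mk 0))).cls ⟨(p i).1, fun _ => (p i).2 1⟩ =
      (b.level (op (.mk 0))).cls ⟨(p i').1, fun _ => (p i').2 0⟩}
  A p := ∀ l, b.A (p.1 l).1
  ne p := ⟨fun l => (b.ne (p.1 l).1).some⟩
  φ j p c := ⟨fun l => (b.level (op (.mk 1))).φ j (p.1 l) (Cell.proj n c l), fun i i' h =>
    (b.endpt_φ 0 j (p.1 i) _).trans ((p.2 i i' h).trans (b.endpt_φ 1 j (p.1 i') _).symm)⟩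
  nat {j k} f p c := Subtype.ext (funext fun l =>
    ((b.level (op (.mk 1))).nat f (p.1 l) _).trans
      (congrArg ((b.level (op (.mk 1))).φ k (p.1 l)) (Cell.proj_map n f c l).symm))
  inj j {p p' c c'} h := by
    have h1 := fun l => (b.level (op (.mk 1))).inj j (congrFun (congrArg Subtype.val h) l)
    obtain ⟨p, hp⟩ := p
    obtain ⟨p', hp'⟩ := p'
    obtain rfl : p = p' := funext fun l => congrArg Sigma.fst (h1 l)
    have h2 : c = c' := by
      rw [← Cell.pi_proj n c, ← Cell.pi_proj n c']
      exact congrArg (Cell.pi n) (funext fun l => eq_of_heq (Sigma.mk.inj_iff.1 (h1 l)).2)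
    rw [h2]
  surj j z := by
    choose p c h using fun l => (b.level (op (.mk 1))).surj j (z.1 l)
    refine ⟨⟨p, fun i i' hi => ?_⟩, Cell.pi n c, Subtype.ext (funext fun l => ?_)⟩
    · have := z.2 i i' hi
      rw [← h i, ← h i'] at this
      exact (b.endpt_φ 0 j (p i) (c i)).symm.trans (this.trans (b.endpt_φ 1 j (p i') (c i')))
    · exact (congrArg (fun z => (b.level (op (.mk 1))).φ j (p l) (z l))
        (Cell.proj_pi n c)).trans (h l)

theorem exists_spine {S : Type u} (A : S → Type) : ∀ (m : ℕ)
    (p : Fin (m + 1) → Σ s, (Fin 2 → A s)),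
    (∀ i i' : Fin (m + 1), i.val + 1 = i'.val →
      (⟨(p i).1, (p i).2 1⟩ : Σ s, A s) = ⟨(p i').1, (p i').2 0⟩) →
    ∃ s, ∃ t : Fin (m + 2) → A s, ∀ i, p i = ⟨s, ![t i.castSucc, t i.succ]⟩
  | 0, p, _ => by
    refine ⟨(p 0).1, (p 0).2, fun i => ?_⟩
    have := Fin.fin_one_eq_zero i
    subst this
    refine Sigma.ext rfl (heq_of_eq ?_)
    funext a
    fin_cases a <;> rfl
  | m + 1, p, h => by
    obtain ⟨s, t, ht⟩ := exists_spine A m (fun i => p i.castSucc)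
      (fun i i' hi => h _ _ hi)
    have h1 := h (Fin.last m).castSucc (Fin.last (m + 1)) rfl
    rw [ht (Fin.last m)] at h1
    rcases hp : p (Fin.last (m + 1)) with ⟨s', v⟩
    rw [hp] at h1
    obtain ⟨rfl, h2⟩ := Sigma.mk.inj_iff.1 h1
    have h3 : t (Fin.last (m + 1)) = v 0 := eq_of_heq h2
    refine ⟨s, Fin.snoc (α := fun _ => A s) t (v 1), fun i => ?_⟩
    induction i using Fin.lastCases with
    | last =>
      rw [hp]
      refine Sigma.ext rfl (heq_of_eq ?_)
      funext a
      fin_cases a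
      · change v 0 = Fin.snoc (α := fun _ => A s) t (v 1) (Fin.last (m + 1)).castSucc
        rw [Fin.snoc_castSucc, h3]
      · change v 1 = Fin.snoc (α := fun _ => A s) t (v 1) (Fin.last (m + 2))
        rw [Fin.snoc_last]
    | cast i =>
      rw [ht i]
      refine Sigma.ext rfl (heq_of_eq ?_)
      funext a
      fin_cases a
      · change t i.castSucc = Fin.snoc (α := fun _ => A s) t (v 1) i.castSucc.castSucc
        rw [Fin.snoc_castSucc]
      · change t i.succ = Fin.snoc (α := fun _ => A s) t (v 1) i.succ.castSucc
        rw [Fin.snoc_castSucc]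

theorem isNEquiv_segalMap (b : BoxData (n + 1) X) (m : ℕ) : IsNEquiv n (segalMap X (m + 1)) := by
  let g : (b.level (op (.mk (m + 1)))).S → (b.segBox (m + 1)).S := fun p =>
    ⟨fun i => ⟨p.1, p.2 ∘ (SimplexCategory.mkOfSucc i).toOrderHom⟩, fun i i' hi => by
      refine congrArg (b.level (op (.mk 0))).cls (congrArg (Sigma.mk p.1) ?_)
      funext _
      exact congrArg p.2 (Fin.ext hi)⟩
  refine isNEquiv n (b.level (op (.mk (m + 1)))) (b.segBox (m + 1)) _ g ⟨?_, ?_⟩ ?_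
  · rintro ⟨s, t⟩ ⟨s', t'⟩ h
    have h1 := fun i => congrFun (congrArg Subtype.val h) i
    obtain rfl : s = s' := congrArg Sigma.fst (h1 0)
    have h2 := fun i => eq_of_heq (Sigma.mk.inj_iff.1 (h1 i)).2
    refine congrArg (Sigma.mk s) (funext fun i => ?_)
    change Fin (m + 2) at i
    induction i using Fin.cases with
    | zero => exact congrFun (h2 0) 0
    | succ i => exact congrFun (h2 i) 1
  · rintro ⟨p, hp⟩
    obtain ⟨s, t, ht⟩ := exists_spine b.A m p (fun i i' hi => by
      have := (b.level (op (.mk 0))).cls_bijective.1 (hp i i' hi)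
      have h2 := congrArg (fun q : (b.level (op (.mk 0))).S => (⟨q.1, q.2 (0 : Fin 1)⟩ : Σ s, b.A s)) this
      exact h2)
    refine ⟨⟨s, t⟩, Subtype.ext (funext fun i => ?_)⟩
    refine Eq.trans ?_ (ht i).symm
    refine congrArg (Sigma.mk s) (funext fun a => ?_)
    change Fin 2 at a
    fin_cases a <;> rfl
  · intro j p c
    refine ⟨Cell.pi n fun _ => c, Subtype.ext (funext fun i => ?_)⟩
    refine (b.nat (j := (op (.mk (m + 1)), j)) (k := (op (.mk 1), j))
      ((SimplexCategory.mkOfSucc i).op, 𝟙 j) p.1 (p.2, c)).trans ?_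
    refine congrArg (b.φ (op (.mk 1), j) p.1) (Prod.ext rfl ?_)
    refine (Cell.map_id n c).trans ?_
    exact (congrFun (Cell.proj_pi n (B := fun _ : Fin (m + 1) => b.A p.1) fun _ => c) i).symm

end Segal

theorem isGCatWG : ∀ (n : ℕ) {X : Idx n ⥤ Type u} (_ : BoxData n X), IsGCatWG n X
  | 0, _, _ => trivial
  | 1, _, b => isNFoldGpd 1 b
  | n + 2, _, b => ⟨isNFoldCat _ b, fun k => isGCatWG (n + 1) (b.level (op (.mk k))),
      isHomDiscrete (n + 1) (b.level (op (.mk 0))), fun k hk => by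
        obtain ⟨m, rfl⟩ : ∃ m, k = m + 1 := ⟨k - 1, by omega⟩
        exact b.isNEquiv_segalMap m, isGCatWG (n + 1) b.truncation⟩

end BoxData

section FreeBox

variable {O : Type u} {E : O → O → Type u} {n : ℕ}

/-- The labellings of the letters of a path by `0` and `1`. -/
def Lab : ∀ {a b : O}, Word E a b → Type
  | _, _, .nil _ => Unit
  | _, _, .cons _ w => Fin 2 × Lab w

theorem Lab.nonempty : ∀ {a b : O} (w : Word E a b), Nonempty (Lab w)
  | _, _, .nil _ => ⟨()⟩
  | _, _, .cons _ w => (nonempty w).elim fun l => ⟨((0 : Fin 2), l)⟩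

/-- A cell of a product of two sets. -/
def Cell.fst {A B : Type} : ∀ n {j : Idx n}, Cell (A × B) n j → Cell A n j
  | 0, _, _ => ⟨⟩
  | n + 1, _, c => (fun i => (c.1 i).1, Cell.fst n c.2)

/-- A cell of a product of two sets. -/
def Cell.snd {A B : Type} : ∀ n {j : Idx n}, Cell (A × B) n j → Cell B n j
  | 0, _, _ => ⟨⟩
  | n + 1, _, c => (fun i => (c.1 i).2, Cell.snd n c.2)

/-- A cell of a product of two sets. -/
def Cell.pair {A B : Type} : ∀ n {j : Idx n}, Cell A n j → Cell B n j → Cell (A × B) n j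
  | 0, _, _, _ => ⟨⟩
  | n + 1, _, c, d => (fun i => (c.1 i, d.1 i), Cell.pair n c.2 d.2)

theorem Cell.pair_fst_snd {A B : Type} : ∀ n {j : Idx n} (c : Cell (A × B) n j),
    Cell.pair n (Cell.fst n c) (Cell.snd n c) = c
  | 0, _, _ => rfl
  | n + 1, _, c => Prod.ext rfl (Cell.pair_fst_snd n c.2)

theorem Cell.fst_pair {A B : Type} : ∀ n {j : Idx n} (c : Cell A n j) (d : Cell B n j),
    Cell.fst n (Cell.pair n c d) = c
  | 0, _, _, _ => rfl
  | n + 1, _, c, d => Prod.ext rfl (Cell.fst_pair n c.2 d.2)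

theorem Cell.snd_pair {A B : Type} : ∀ n {j : Idx n} (c : Cell A n j) (d : Cell B n j),
    Cell.snd n (Cell.pair n c d) = d
  | 0, _, _, _ => rfl
  | n + 1, _, c, d => Prod.ext rfl (Cell.snd_pair n c.2 d.2)

theorem Cell.fst_map {A B : Type} : ∀ n {j k : Idx n} (f : j ⟶ k) (c : Cell (A × B) n j),
    Cell.fst n (Cell.map n f c) = Cell.map n f (Cell.fst n c)
  | 0, _, _, _, _ => rfl
  | n + 1, _, _, f, c => Prod.ext rfl (Cell.fst_map n f.2 c.2)

theorem Cell.snd_map {A B : Type} : ∀ n {j k : Idx n} (f : j ⟶ k) (c : Cell (A × B) n j),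
    Cell.snd n (Cell.map n f c) = Cell.map n f (Cell.snd n c)
  | 0, _, _, _, _ => rfl
  | n + 1, _, _, f, c => Prod.ext rfl (Cell.snd_map n f.2 c.2)

/-- The path of pairs (letter, cell) given by a path and a cell of the set of labellings. -/
def ofLab (j : Idx n) : ∀ {a b : O} (w : Word E a b), Cell (Lab w) n j →
    Word (fun a b => E a b × Cell (Fin 2) n j) a b
  | _, _, .nil a, _ => .nil a
  | _, _, .cons e w, c => .cons (e, Cell.fst (B := Lab w) n c) (ofLab j w (Cell.snd n c))

theorem ofLab_nat {j k : Idx n} (f : j ⟶ k) {a b : O} (w : Word E a b) (c : Cell (Lab w) n j) :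
    Word.map (E := fun a b => E a b × Cell (Fin 2) n j)
      (E' := fun a b => E a b × Cell (Fin 2) n k) (fun e => (e.1, Cell.map n f e.2))
      (ofLab j w c) = ofLab k w (Cell.map n f c) := by
  induction w with
  | nil => rfl
  | @cons a b c' e w ih =>
    have h1 := Cell.fst_map (A := Fin 2) (B := Lab w) n f c
    have h2 := Cell.snd_map (A := Fin 2) (B := Lab w) n f c
    exact congrArg₂ (Word.cons (E := fun a b => E a b × Cell (Fin 2) n k))
      (Prod.ext rfl h1.symm) ((ih _).trans (congrArg (ofLab k w) h2.symm))

theorem fst_ofLab {j : Idx n} {a b : O} (w : Word E a b) (c : Cell (Lab w) n j) :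
    Word.map (E := fun a b => E a b × Cell (Fin 2) n j) (fun e => e.1) (ofLab j w c) = w := by
  induction w with
  | nil => rfl
  | @cons a b c' e w ih => exact congrArg (Word.cons e) (ih _)

theorem cell_punit_eq : ∀ n {j : Idx n} (c c' : Cell Unit n j), c = c'
  | 0, _, _, _ => rfl
  | n + 1, _, c, c' => Prod.ext (funext fun _ => rfl) (cell_punit_eq n c.2 c'.2)

theorem ofLab_inj {j : Idx n} {a b : O} (w : Word E a b) (c c' : Cell (Lab w) n j)
    (h : ofLab j w c = ofLab j w c') : c = c' := by
  induction w with
  | nil => exact cell_punit_eq n c c'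
  | @cons a b d e w ih =>
    obtain ⟨_, h1, h2⟩ := Word.cons.inj h
    have h3 : Cell.fst (A := Fin 2) (B := Lab w) n c = Cell.fst (A := Fin 2) (B := Lab w) n c' :=
      congrArg Prod.snd (eq_of_heq h1)
    have h4 := ih _ _ (eq_of_heq h2)
    exact (Cell.pair_fst_snd (A := Fin 2) (B := Lab w) n c).symm.trans
      ((congrArg₂ (Cell.pair n) h3 h4).trans (Cell.pair_fst_snd (A := Fin 2) (B := Lab w) n c'))

theorem ofLab_surj {j : Idx n} {a b : O} (x : Word (fun a b => E a b × Cell (Fin 2) n j) a b) :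
    ∃ w c, ofLab j w c = x := by
  induction x with
  | nil a => exact ⟨.nil a, Cell.diag n j (), rfl⟩
  | @cons a b d e x ih =>
    obtain ⟨w, c, rfl⟩ := ih
    refine ⟨.cons e.1 w, Cell.pair (A := Fin 2) (B := Lab w) n e.2 c, ?_⟩
    exact congrArg₂ (Word.cons (E := fun a b => E a b × Cell (Fin 2) n j))
      (Prod.ext rfl (Cell.fst_pair (A := Fin 2) (B := Lab w) n e.2 c))
      (congrArg (ofLab j w) (Cell.snd_pair (A := Fin 2) (B := Lab w) n e.2 c))

/-- The box structure of the hom-objects of a free `n`-fold groupoid. -/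
def freeBox (n : ℕ) (G : GphO O) (a b : O) : BoxData n (homSet (freeMS n G) a b) where
  S := Word G.Edge a b
  A w := Lab w
  ne w := Lab.nonempty w
  φ j w c := ofLab j w c
  nat f w c := ofLab_nat f w c
  inj j {w w' c c'} h := by
    have h1 := congrArg (Word.map (E := fun a b => G.Edge a b × Cell (Fin 2) n j) (fun e => e.1)) h
    rw [fst_ofLab, fst_ofLab] at h1
    subst h1
    rw [ofLab_inj w c c' h]
  surj j x := ofLab_surj x

end FreeBox

/-- The free `n`-track category `Lₙ F G` on a graph `G`. -/
def freeTrack {O : Type u} (n : ℕ) (G : GphO O) : NTrack n O :=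
  ⟨freeMS n G, fun a b => ⟨(freeBox n G a b).isGCatWG, (freeBox n G a b).isNFoldGpd⟩⟩

/-- The functor `V Uₙ`, sending an `n`-track category to the underlying graph of its category of
arrows `X₁…₁`. -/
def forgetGph (n : ℕ) (O : Type u) : NTrack n O ⥤ GphO O where
  obj X := ⟨(X.obj.obj (Idx.one n)).Arr⟩
  map F := fun _ _ x => (F.hom.app (Idx.one n)).app x

/-- Maps from a free `n`-track category are the maps of graphs defined on its generators. -/
noncomputable def freeEquiv {O : Type u} (n : ℕ) (G : GphO O) (X : NTrack n O) :
    (freeTrack n G ⟶ X) ≃ (G ⟶ (forgetGph n O).obj X) :=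
  Equiv.ofBijective
    (fun F _ b e => (F.hom.app (Idx.one n)).app
      (Word.cons (E := fun a b => G.Edge a b × Cell (Fin 2) n (Idx.one n)) (e, Cell.gen n)
        (Word.nil b)))
    ((freeMS_hom_bijective n G X.obj fun a b => (X.property a b).2).comp
      (ObjectProperty.fullyFaithfulι _).homEquiv.bijective)

/-- The adjunction between `n`-track categories and graphs. -/
noncomputable def freeAdj (n : ℕ) (O : Type u) :
    Adjunction.leftAdjointOfEquiv (G := forgetGph n O) (F_obj := freeTrack n)
      (fun G X => freeEquiv n G X) (fun _ _ _ _ _ => rfl) ⊣ forgetGph n O :=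
  Adjunction.adjunctionOfEquivLeft _ _

/-- The comonad `𝒦 = Lₙ F V Uₙ` on `n`-track categories, with counit `ε` the counit of the adjunction
`Lₙ F ⊣ V Uₙ` and comultiplication `δ` induced by its unit. -/
noncomputable def trackComonad (n : ℕ) (O : Type u) : Comonad (NTrack n O) :=
  (freeAdj n O).toComonad

section Resolution

variable {C : Type v} [Category.{w} C] (K : Comonad C) (X : C)

/-- `Kˢ X`. -/
def iterK : ℕ → C
  | 0 => X
  | s + 1 => K.obj (iterK s)

/-- The maps `Kⁱ ε Kˢ⁻ⁱ : Kˢ⁺¹ X → Kˢ X`. -/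
def iterFace : ∀ s : ℕ, Fin (s + 1) → (iterK K X (s + 1) ⟶ iterK K X s)
  | 0 => fun _ => K.ε.app X
  | s + 1 => Fin.cases (K.ε.app (iterK K X (s + 1))) fun i => K.map (iterFace s i)

/-- The maps `Kⁱ δ Kˢ⁻ⁱ : Kˢ⁺¹ X → Kˢ⁺² X`. -/
def iterDegen : ∀ s : ℕ, Fin (s + 1) → (iterK K X (s + 1) ⟶ iterK K X (s + 2))
  | 0 => fun _ => K.δ.app X
  | s + 1 => Fin.cases (K.δ.app (iterK K X (s + 1))) fun i => K.map (iterDegen s i)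

/-- The iterated augmentation `Kˢ X → X`. -/
def iterAug : ∀ s : ℕ, iterK K X s ⟶ X
  | 0 => 𝟙 X
  | s + 1 => K.ε.app (iterK K X s) ≫ iterAug s

/-- The object `Kₛ X = Kˢ⁺¹ X` of the comonad resolution of `X`. -/
abbrev resObj (s : ℕ) : C := iterK K X (s + 1)

/-- The face maps `∂ᵢ : Kₛ₊₁ X → Kₛ X`. -/
abbrev resFace (s : ℕ) (i : Fin (s + 2)) : resObj K X (s + 1) ⟶ resObj K X s :=
  iterFace K X (s + 1) i

/-- The degeneracy maps `σᵢ : Kₛ X → Kₛ₊₁ X`. -/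
abbrev resDegen (s : ℕ) (i : Fin (s + 1)) : resObj K X s ⟶ resObj K X (s + 1) :=
  iterDegen K X s i

/-- The iterated face map `d_I : Kₛ X → X`. -/
abbrev resAug (s : ℕ) : resObj K X s ⟶ X := iterAug K X (s + 1)

end Resolution

/-! ### Modules -/

section Modules

variable {O : Type u}

/-- The fibre over `q` of a map of simplicial objects in `Cat_O`. -/
abbrev Fib {M Q : SimplexCategoryᵒᵖ ⥤ CatO O} (ρ : M ⟶ Q) {k : SimplexCategoryᵒᵖ} {a b : O}
    (q : (Q.obj k).Arr a b) : Type u := {m : (M.obj k).Arr a b // (ρ.app k).app m = q}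

namespace Fib

variable {M Q : SimplexCategoryᵒᵖ ⥤ CatO O} {ρ : M ⟶ Q}

/-- The simplicial operators on fibres. -/
def map {k l : SimplexCategoryᵒᵖ} (f : k ⟶ l) {a b : O} {q : (Q.obj k).Arr a b} (x : Fib ρ q) :
    Fib ρ ((Q.map f).app q) :=
  ⟨(M.map f).app x.1, by rw [CatO.naturality_app, x.2]⟩

/-- The composition on fibres. -/
def mul {k : SimplexCategoryᵒᵖ} {a b c : O} {q : (Q.obj k).Arr a b} {r : (Q.obj k).Arr b c}
    (x : Fib ρ q) (y : Fib ρ r) : Fib ρ ((Q.obj k).mul q r) :=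
  ⟨(M.obj k).mul x.1 y.1, by rw [CatO.Fun.app_mul, x.2, y.2]⟩

/-- The identities on fibres. -/
def one (ρ : M ⟶ Q) (k : SimplexCategoryᵒᵖ) (a : O) : Fib ρ ((Q.obj k).one a) :=
  ⟨(M.obj k).one a, (ρ.app k).app_one a⟩

end Fib

/-- An abelian group object in simplicial objects of `Cat_O` over `Q`: an abelian group structure
on each fibre of `M → Q`, such that the addition `M ×_Q M → M` is a map of simplicial objects of
`Cat_O`. (The zero section and the inverse are then maps of simplicial objects of `Cat_O`.) -/
structure GrpOver (Q : SimplexCategoryᵒᵖ ⥤ CatO O) where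
  tot : SimplexCategoryᵒᵖ ⥤ CatO O
  proj : tot ⟶ Q
  grp : ∀ {k : SimplexCategoryᵒᵖ} {a b : O} (q : (Q.obj k).Arr a b), AddCommGroup (Fib proj q)
  map_add : ∀ {k l : SimplexCategoryᵒᵖ} (f : k ⟶ l) {a b : O} {q : (Q.obj k).Arr a b}
    (x y : Fib proj q), (x + y).map f = x.map f + y.map f
  mul_add : ∀ {k : SimplexCategoryᵒᵖ} {a b c : O} {q : (Q.obj k).Arr a b}
    {r : (Q.obj k).Arr b c} (x y : Fib proj q) (x' y' : Fib proj r),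
    (x + y).mul (x' + y') = x.mul x' + y.mul y'
  one_add : ∀ (k : SimplexCategoryᵒᵖ) (a : O),
    Fib.one proj k a + Fib.one proj k a = Fib.one proj k a

attribute [instance] GrpOver.grp

/-- A module over the track category `Q`: an abelian group object in track categories over `Q`
having the same category of objects as `Q`. -/
structure TrackModule (Q : SimplexCategoryᵒᵖ ⥤ CatO O) extends GrpOver Q where
  isGpd : ∀ a b, IsGpdNerve (tot ⋙ CatO.homF a b)
  proj_zero : ∀ a b,
    Function.Bijective (fun m : (tot.obj (op (.mk 0))).Arr a b => (proj.app (op (.mk 0))).app m)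

namespace GrpOver

variable {Q W : SimplexCategoryᵒᵖ ⥤ CatO O}

theorem add_congr (M : GrpOver Q) {k : SimplexCategoryᵒᵖ} {a b : O} {q q' : (Q.obj k).Arr a b}
    {x y : Fib M.proj q} {x' y' : Fib M.proj q'} (hq : q = q') (hx : x.1 = x'.1)
    (hy : y.1 = y'.1) : (x + y).1 = (x' + y').1 := by
  subst hq
  obtain rfl := Subtype.ext hx
  obtain rfl := Subtype.ext hy
  rfl

section Pullback

variable (M : GrpOver Q) (f : W ⟶ Q)

/-- The pullback of `M → Q` along `f : W → Q`. -/
def pbTot : SimplexCategoryᵒᵖ ⥤ CatO O where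
  obj k :=
    { Arr a b := {x : (W.obj k).Arr a b × (M.tot.obj k).Arr a b //
        (M.proj.app k).app x.2 = (f.app k).app x.1}
      one a := ⟨((W.obj k).one a, (M.tot.obj k).one a), by
        rw [CatO.Fun.app_one, CatO.Fun.app_one]⟩
      mul x y := ⟨((W.obj k).mul x.1.1 y.1.1, (M.tot.obj k).mul x.1.2 y.1.2), by
        rw [CatO.Fun.app_mul, CatO.Fun.app_mul, x.2, y.2]⟩
      one_mul x := Subtype.ext (Prod.ext ((W.obj k).one_mul _) ((M.tot.obj k).one_mul _))
      mul_one x := Subtype.ext (Prod.ext ((W.obj k).mul_one _) ((M.tot.obj k).mul_one _))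
      assoc x y z := Subtype.ext (Prod.ext ((W.obj k).assoc _ _ _) ((M.tot.obj k).assoc _ _ _)) }
  map {k l} g :=
    { app x := ⟨((W.map g).app x.1.1, (M.tot.map g).app x.1.2), by
        rw [CatO.naturality_app, CatO.naturality_app, x.2]⟩
      app_one a := Subtype.ext (Prod.ext ((W.map g).app_one a) ((M.tot.map g).app_one a))
      app_mul x y := Subtype.ext (Prod.ext ((W.map g).app_mul _ _) ((M.tot.map g).app_mul _ _)) }
  map_id k := CatO.hom_ext fun x =>
    Subtype.ext (Prod.ext (CatO.map_id_app W _) (CatO.map_id_app M.tot _))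
  map_comp g h := CatO.hom_ext fun x =>
    Subtype.ext (Prod.ext (CatO.map_comp_app W g h _) (CatO.map_comp_app M.tot g h _))

/-- The projection of the pullback. -/
def pbProj : M.pbTot f ⟶ W where
  app k :=
    { app x := x.1.1
      app_one _ := rfl
      app_mul _ _ := rfl }

/-- The fibres of the pullback are the fibres of `M`. -/
def pbFib {k : SimplexCategoryᵒᵖ} {a b : O} (w : (W.obj k).Arr a b) :
    Fib (M.pbProj f) w ≃ Fib M.proj ((f.app k).app w) where
  toFun x := ⟨x.1.1.2, x.1.2.trans (congrArg (f.app k).app x.2)⟩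
  invFun y := ⟨⟨(w, y.1), y.2⟩, rfl⟩
  left_inv x := Subtype.ext (Subtype.ext (Prod.ext x.2.symm rfl))
  right_inv _ := rfl

theorem pbFib_eq {k : SimplexCategoryᵒᵖ} {a b : O} {w : (W.obj k).Arr a b}
    {x y : Fib (M.pbProj f) w} (h : x.1.1.2 = y.1.1.2) : x = y :=
  (M.pbFib f w).injective (Subtype.ext h)

/-- The pullback `f^* M` of an abelian group object. -/
def pb : GrpOver W where
  tot := M.pbTot f
  proj := M.pbProj f
  grp w := (M.pbFib f w).addCommGroup
  map_add {k l} g {a b} w x y := by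
    let _ : ∀ {k : SimplexCategoryᵒᵖ} {a b : O} (w : (W.obj k).Arr a b),
      AddCommGroup (Fib (M.pbProj f) w) := fun w => (M.pbFib f w).addCommGroup
    refine M.pbFib_eq f ?_
    have h1 := congrArg Subtype.val (M.map_add g (M.pbFib f w x) (M.pbFib f w y))
    refine h1.trans ?_
    exact M.add_congr (CatO.naturality_app f g w).symm rfl rfl
  mul_add {k a b c w w'} x y x' y' := by
    let _ : ∀ {k : SimplexCategoryᵒᵖ} {a b : O} (w : (W.obj k).Arr a b),
      AddCommGroup (Fib (M.pbProj f) w) := fun w => (M.pbFib f w).addCommGroup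
    refine M.pbFib_eq f ?_
    have h1 := congrArg Subtype.val (M.mul_add (M.pbFib f w x) (M.pbFib f w y)
      (M.pbFib f w' x') (M.pbFib f w' y'))
    refine h1.trans ?_
    exact M.add_congr ((f.app k).app_mul w w').symm rfl rfl
  one_add k a := by
    let _ : ∀ {k : SimplexCategoryᵒᵖ} {a b : O} (w : (W.obj k).Arr a b),
      AddCommGroup (Fib (M.pbProj f) w) := fun w => (M.pbFib f w).addCommGroup
    refine M.pbFib_eq f ?_
    refine Eq.trans ?_ (congrArg Subtype.val (M.one_add k a))
    exact M.add_congr ((f.app k).app_one a) rfl rfl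

end Pullback

end GrpOver

end Modules

/-! ### Eilenberg-Mac Lane objects -/

/-- In each of `n` directions, a pair of vertices of a simplex. -/
def Pairs : ∀ n, Idx n → Type
  | 0, _ => Unit
  | n + 1, k => (Fin (k.1.unop.len + 1) × Fin (k.1.unop.len + 1)) × Pairs n k.2

/-- The effect on vertices of simplicial operators. -/
def Pairs.map : ∀ n {j k : Idx n}, (j ⟶ k) → Pairs n k → Pairs n j
  | 0, _, _, _, _ => ()
  | n + 1, _, _, f, p =>
    ((f.1.unop.toOrderHom p.1.1, f.1.unop.toOrderHom p.1.2), Pairs.map n f.2 p.2)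

theorem Pairs.map_id : ∀ n {j : Idx n} (p : Pairs n j), Pairs.map n (𝟙 j) p = p
  | 0, _, _ => rfl
  | n + 1, _, p => Prod.ext rfl (Pairs.map_id n p.2)

theorem Pairs.map_comp : ∀ n {j k l : Idx n} (f : j ⟶ k) (g : k ⟶ l) (p : Pairs n l),
    Pairs.map n (f ≫ g) p = Pairs.map n f (Pairs.map n g p)
  | 0, _, _, _, _, _, _ => rfl
  | n + 1, _, _, _, f, g, p => Prod.ext rfl (Pairs.map_comp n f.2 g.2 p.2)

/-- In each of the `n` directions, `c` satisfies the cocycle condition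
`c(x₀, x₁) + c(x₁, x₂) = c(x₀, x₂)`. Such functions are the simplices of the multinerve of
the `n`-fold groupoid with one object given by the abelian group `G`. -/
def IsCocycle {G : Type u} [AddCommGroup G] : ∀ n {j : Idx n}, (Pairs n j → G) → Prop
  | 0, _, _ => True
  | n + 1, _, c => (∀ x₀ x₁ x₂ p, c ((x₀, x₁), p) + c ((x₁, x₂), p) = c ((x₀, x₂), p)) ∧
      ∀ x, IsCocycle n fun p => c (x, p)

theorem IsCocycle.zero {G : Type u} [AddCommGroup G] : ∀ n {j : Idx n} (c : Pairs n j → G)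
    (_ : ∀ p, c p = 0), IsCocycle n c
  | 0, _, _, _ => trivial
  | n + 1, _, _, h => ⟨fun _ _ _ _ => (congrArg₂ _ (h _) (h _)).trans ((add_zero _).trans (h _).symm),
      fun _ => IsCocycle.zero n _ fun _ => h _⟩

theorem IsCocycle.comp {G : Type u} [AddCommGroup G] : ∀ n {j k : Idx n} (f : j ⟶ k)
    {c : Pairs n j → G} (_ : IsCocycle n c), IsCocycle n fun p => c (Pairs.map n f p)
  | 0, _, _, _, _, _ => trivial
  | n + 1, _, _, f, _, h => ⟨fun _ _ _ _ => h.1 _ _ _ _, fun x => IsCocycle.comp n f.2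
      (h.2 (f.1.unop.toOrderHom x.1, f.1.unop.toOrderHom x.2))⟩

theorem IsCocycle.map {G G' : Type u} [AddCommGroup G] [AddCommGroup G'] (φ : G → G')
    (hφ : ∀ x y, φ (x + y) = φ x + φ y) : ∀ n {j : Idx n} {c : Pairs n j → G}
    (_ : IsCocycle n c), IsCocycle n fun p => φ (c p)
  | 0, _, _, _ => trivial
  | n + 1, _, _, h => ⟨fun _ _ _ _ => (hφ _ _).symm.trans (congrArg φ (h.1 _ _ _ _)),
      fun _ => IsCocycle.map φ hφ n (h.2 _)⟩

theorem IsCocycle.prod {G G' : Type u} [AddCommGroup G] [AddCommGroup G'] : ∀ n {j : Idx n}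
    {c : Pairs n j → G} {c' : Pairs n j → G'} (_ : IsCocycle n c) (_ : IsCocycle n c'),
    IsCocycle n fun p => (c p, c' p)
  | 0, _, _, _, _, _ => trivial
  | n + 1, _, _, _, h, h' => ⟨fun _ _ _ _ => Prod.ext (h.1 _ _ _ _) (h'.1 _ _ _ _),
      fun _ => IsCocycle.prod n (h.2 _) (h'.2 _)⟩

section EilenbergMacLane

variable {O : Type u} {Q W : SimplexCategoryᵒᵖ ⥤ CatO O}

/-- The arrows from `a` to `b` of the category `E⁽ⁿ⁺¹⁾(Q, M)ₖ,ⱼ`. -/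
@[ext]
structure EMArr (n : ℕ) (M : GrpOver Q) (k : SimplexCategoryᵒᵖ) (j : Idx n) (a b : O) :
    Type u where
  base : (Q.obj k).Arr a b
  val : Pairs n j → (M.tot.obj k).Arr a b
  mem : ∀ p, (M.proj.app k).app (val p) = base
  cocycle : IsCocycle n fun p => (⟨val p, mem p⟩ : Fib M.proj base)

/-- `w` is the sum of `u` and `v` for the abelian group structure of `E⁽ⁿ⁺¹⁾(Q, M)` over `Q`. -/
def EMArr.IsSum {n : ℕ} {M : GrpOver Q} {k : SimplexCategoryᵒᵖ} {j : Idx n} {a b : O}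
    (u v w : EMArr n M k j a b) : Prop :=
  ∃ h : v.base = u.base, w.base = u.base ∧
    ∀ p, w.val p = ((⟨u.val p, u.mem p⟩ : Fib M.proj u.base) +
      (⟨v.val p, (v.mem p).trans h⟩ : Fib M.proj u.base)).1

/-- The multinerve of the Eilenberg-Mac Lane object `E⁽ⁿ⁺¹⁾(Q, M)`, the `n`-fold iterated
delooping over `Q` of the abelian group object `M`: starting from `E⁽¹⁾(Q, M) = M`,
each further direction is the nerve of the groupoid
`E⁽ᵐ⁾ ×_Q E⁽ᵐ⁾ → E⁽ᵐ⁾ ⇉ Q` given by the addition. The first index is that of `M` and `Q`. -/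
def EM (n : ℕ) (M : GrpOver Q) : Idx (n + 1) ⥤ CatO O where
  obj x :=
    { Arr := EMArr n M x.1 x.2
      one a :=
        { base := (Q.obj x.1).one a
          val _ := (M.tot.obj x.1).one a
          mem _ := (M.proj.app x.1).app_one a
          cocycle := IsCocycle.zero n _ fun _ => left_eq_add.1 (M.one_add x.1 a).symm }
      mul {a b c} u v :=
        { base := (Q.obj x.1).mul u.base v.base
          val p := (M.tot.obj x.1).mul (u.val p) (v.val p)
          mem p := by rw [CatO.Fun.app_mul, u.mem, v.mem]
          cocycle := IsCocycle.map (fun z : Fib M.proj u.base × Fib M.proj v.base => z.1.mul z.2)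
            (fun z z' => M.mul_add z.1 z'.1 z.2 z'.2) n (IsCocycle.prod n u.cocycle v.cocycle) }
      one_mul u := EMArr.ext ((Q.obj x.1).one_mul _) (funext fun _ => (M.tot.obj x.1).one_mul _)
      mul_one u := EMArr.ext ((Q.obj x.1).mul_one _) (funext fun _ => (M.tot.obj x.1).mul_one _)
      assoc u v w := EMArr.ext ((Q.obj x.1).assoc _ _ _)
        (funext fun _ => (M.tot.obj x.1).assoc _ _ _) }
  map {x y} f :=
    { app u :=
        { base := (Q.map f.1).app u.base
          val p := (M.tot.map f.1).app (u.val (Pairs.map n f.2 p))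
          mem p := by rw [CatO.naturality_app, u.mem]
          cocycle := IsCocycle.map (fun z : Fib M.proj u.base => z.map f.1)
            (fun z z' => M.map_add f.1 z z') n (IsCocycle.comp n f.2 u.cocycle) }
      app_one a := EMArr.ext ((Q.map f.1).app_one a) (funext fun _ => (M.tot.map f.1).app_one a)
      app_mul u v := EMArr.ext ((Q.map f.1).app_mul _ _)
        (funext fun _ => (M.tot.map f.1).app_mul _ _) }
  map_id x := CatO.hom_ext fun u => EMArr.ext (CatO.map_id_app Q _) (funext fun p =>
    (CatO.map_id_app M.tot _).trans (congrArg u.val (Pairs.map_id n p)))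
  map_comp f g := CatO.hom_ext fun u => EMArr.ext (CatO.map_comp_app Q f.1 g.1 _)
    (funext fun p => (CatO.map_comp_app M.tot f.1 g.1 _).trans (congrArg (fun z =>
      (M.tot.map g.1).app ((M.tot.map f.1).app (u.val z))) (Pairs.map_comp n f.2 g.2 p)))

/-- The projection `E⁽ⁿ⁺¹⁾(Q, M) → d⁽ⁿ⁾ Q`. -/
def EMproj (n : ℕ) (M : GrpOver Q) : EM n M ⟶ (dsc n O).obj Q where
  app x :=
    { app u := u.base
      app_one _ := rfl
      app_mul _ _ := rfl }

/-- The map `E⁽ⁿ⁺¹⁾(W, f^* M) → E⁽ⁿ⁺¹⁾(Q, M)` covering `f : W → Q`. -/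
def EMmap (n : ℕ) (M : GrpOver Q) (f : W ⟶ Q) : EM n (M.pb f) ⟶ EM n M where
  app x :=
    { app {a b} u :=
        { base := (f.app x.1).app u.base
          val p := (u.val p).1.2
          mem p := (u.val p).2.trans (congrArg (f.app x.1).app (u.mem p))
          cocycle := IsCocycle.map (G := Fib (M.pb f).proj u.base) (M.pbFib f u.base)
            (fun z z' => (M.pbFib f u.base).apply_symm_apply _) n u.cocycle }
      app_one a := EMArr.ext ((f.app x.1).app_one a) rfl
      app_mul u v := EMArr.ext ((f.app x.1).app_mul _ _) rfl }
  naturality x y g := CatO.hom_ext fun u => EMArr.ext (CatO.naturality_app f g.1 _) rfl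

end EilenbergMacLane

/-! ### The groups `Dˢ` -/

section CochainGroups

variable {O : Type u} {n : ℕ} (X : NTrack (n + 1) O) (M : TrackModule ((pOne n O).obj X.obj))

/-- The object `𝒦ₛ X` of the comonad resolution of `X`. -/
noncomputable abbrev KRes (s : ℕ) : NTrack (n + 1) O := resObj (trackComonad (n + 1) O) X s

/-- The pullback `d_I^* M` of the module `M` along `p⁽¹⁾ d_I : p⁽¹⁾ 𝒦ₛ X → p⁽¹⁾ X`. -/
noncomputable abbrev resModule (s : ℕ) : GrpOver ((pOne n O).obj (KRes X s).obj) :=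
  M.toGrpOver.pb ((pOne n O).map (resAug (trackComonad (n + 1) O) X s).hom)

/-- The set `Dˢ` of maps from `𝒦ₛ X` to `E⁽ⁿ⁺¹⁾(p⁽¹⁾ 𝒦ₛ X, d_I^* M)` over
`d⁽ⁿ⁾ p⁽¹⁾ 𝒦ₛ X`. -/
abbrev DSet (s : ℕ) : Type u :=
  Over.mk (toPOne n (KRes X s).obj) ⟶ Over.mk (EMproj n (resModule X M s))

/-- The composite of an element of `Dˢ` with the map
`E⁽ⁿ⁺¹⁾(p⁽¹⁾ 𝒦ₛ X, d_I^* M) → E⁽ⁿ⁺¹⁾(p⁽¹⁾ X, M)`. -/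
noncomputable def DSet.toBase {s : ℕ} (g : DSet X M s) : (KRes X s).obj ⟶ EM n M.toGrpOver :=
  g.left ≫ EMmap n M.toGrpOver ((pOne n O).map (resAug (trackComonad (n + 1) O) X s).hom)

/-- `z` is the sum of `x` and `y` for the fibrewise addition of
`E⁽ⁿ⁺¹⁾(p⁽¹⁾ 𝒦ₛ X, d_I^* M)`. -/
def DSet.IsSum {s : ℕ} (x y z : DSet X M s) : Prop :=
  ∀ (j : Idx (n + 1)) (a b : O) (r : ((KRes X s).obj.obj j).Arr a b),
    EMArr.IsSum ((x.left.app j).app r) ((y.left.app j).app r) ((z.left.app j).app r)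

end CochainGroups

/-!
The coface and codegeneracy maps come from one presheaf evaluated on one simplicial object.

An element of `Dˢ` is a map to `E⁽ⁿ⁺¹⁾(p⁽¹⁾ 𝒦ₛ X, d_I^* M)` over `d⁽ⁿ⁾ p⁽¹⁾ 𝒦ₛ X`. As this object is the
pullback of `E⁽ⁿ⁺¹⁾(p⁽¹⁾ X, M)` along `d⁽ⁿ⁾ p⁽¹⁾ d_I`, and `Y → d⁽ⁿ⁾ p⁽¹⁾ Y` is natural in `Y`
(`toPOne_naturality`), such elements are the maps `𝒦ₛ X → E⁽ⁿ⁺¹⁾(p⁽¹⁾ X, M)` over `d⁽ⁿ⁾ p⁽¹⁾ X`, where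
`𝒦ₛ X` lies over it through `𝒦ₛ X → X → d⁽ⁿ⁾ p⁽¹⁾ X` (`sections.overEquiv`). The target no longer
depends on `s`, and for any `Q` and `M`, the maps to `E⁽ⁿ⁺¹⁾(Q, M)` over `d⁽ⁿ⁾ Q` form a presheaf of abelian
groups `sectionsFunctor n M` on the category of objects over `d⁽ⁿ⁾ Q`, with the fibrewise addition.

It remains to see that the comonad resolution is a simplicial object augmented over `X`
(`resolution`, `resolution_map_aug`). Rather than checking the simplicial identities on faces and
degeneracies and passing to arbitrary maps of simplices by normal forms, every order-preserving map
is made to act on the powers of the comonad. Such a map `{0, …, m-1} → {0, …, n-1}` is built in a unique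
way by two operations (`MonoCode`), which act through the counit and by coextension.
Functoriality (`MonoCode.act_comp`) then only uses the two laws of coextension.
-/

/-! ### The simplicial resolution of a comonad -/

/-- The order-preserving maps `{0, …, m-1} → {0, …, n-1}`, built up from the least element of
the target: either `0` is not a value, and the map is one to the remaining elements (`skip`), or `0`
is sent to `0`, and the rest of the map is one from the remaining elements (`hit`). Each map has
exactly one such code. -/
inductive MonoCode : ℕ → ℕ → Type
  | nil : MonoCode 0 0
  | skip {m n : ℕ} (c : MonoCode m n) : MonoCode m (n + 1)
  | hit {m n : ℕ} (c : MonoCode m (n + 1)) : MonoCode (m + 1) (n + 1)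

namespace MonoCode

/-- The map given by a code. -/
def eval : ∀ {m n : ℕ}, MonoCode m n → Fin m → Fin n
  | _, _, nil => id
  | _, _, skip c => fun i => (eval c i).succ
  | _, _, hit c => Fin.cases 0 (eval c)

theorem eval_injective : ∀ {m n : ℕ} (c c' : MonoCode m n), c.eval = c'.eval → c = c'
  | _, _, nil, nil, _ => rfl
  | _, _, skip c, skip c', h =>
    congrArg skip (eval_injective c c' (funext fun i => Fin.succ_injective _ (congrFun h i)))
  | _, _, skip _, hit _, h => absurd (congrFun h 0) (Fin.succ_ne_zero _)
  | _, _, hit _, skip _, h => absurd (congrFun h 0).symm (Fin.succ_ne_zero _)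
  | _, _, hit c, hit c', h =>
    congrArg hit (eval_injective c c' (funext fun i => congrFun h i.succ))

theorem exists_eval : ∀ (n m : ℕ) (f : Fin m → Fin n), Monotone f →
    ∃ c : MonoCode m n, c.eval = f
  | 0, 0, _, _ => ⟨nil, Subsingleton.elim _ _⟩
  | 0, _ + 1, f, _ => (f 0).elim0
  | n + 1, 0, _, _ => by
    obtain ⟨c, -⟩ := exists_eval n 0 Fin.elim0 fun i => i.elim0
    exact ⟨skip c, Subsingleton.elim _ _⟩
  | n + 1, m + 1, f, hf => by
    by_cases h : f 0 = 0
    · obtain ⟨c, hc⟩ := exists_eval (n + 1) m (f ∘ Fin.succ)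
        (hf.comp (Fin.strictMono_succ.monotone))
      refine ⟨hit c, funext fun i => ?_⟩
      induction i using Fin.cases with
      | zero => exact h.symm
      | succ i => exact congrFun hc i
    · have h' : ∀ i, f i ≠ 0 := fun i hi =>
        h (le_antisymm ((hf (Fin.zero_le i)).trans hi.le) (Fin.zero_le _))
      obtain ⟨c, hc⟩ := exists_eval n (m + 1) (fun i => (f i).pred (h' i)) fun i j hij =>
        Fin.pred_le_pred_iff.2 (hf hij)
      refine ⟨skip c, funext fun i => ?_⟩
      exact (congrArg Fin.succ (congrFun hc i)).trans (Fin.succ_pred _ _)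

/-- The code of the identity. -/
def idCode : ∀ n : ℕ, MonoCode n n
  | 0 => nil
  | n + 1 => hit (skip (idCode n))

theorem eval_idCode : ∀ n : ℕ, (idCode n).eval = id
  | 0 => rfl
  | n + 1 => funext fun i => by
    induction i using Fin.cases with
    | zero => rfl
    | succ i => exact congrArg Fin.succ (congrFun (eval_idCode n) i)

/-- The code of the map which omits the value `i`. -/
def faceCode : ∀ (n : ℕ) (_ : Fin (n + 1)), MonoCode n (n + 1)
  | 0 => fun _ => skip nil
  | n + 1 => Fin.cases (skip (idCode (n + 1))) fun i => hit (skip (faceCode n i))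

theorem eval_faceCode : ∀ (n : ℕ) (i : Fin (n + 1)), (faceCode n i).eval = i.succAbove
  | 0, _ => funext fun j => j.elim0
  | n + 1, i => by
    induction i using Fin.cases with
    | zero => exact funext fun j => congrArg Fin.succ (congrFun (eval_idCode (n + 1)) j)
    | succ i =>
      funext j
      induction j using Fin.cases with
      | zero => rfl
      | succ j =>
        exact (congrArg Fin.succ (congrFun (eval_faceCode n i) j)).trans
          (Fin.succ_succAbove_succ i j).symm

/-- The code of the map which takes the value `i` twice. -/
def degenCode : ∀ (n : ℕ) (_ : Fin (n + 1)), MonoCode (n + 2) (n + 1)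
  | 0 => fun _ => hit (hit (skip nil))
  | n + 1 => Fin.cases (hit (hit (skip (idCode (n + 1))))) fun i => hit (skip (degenCode n i))

theorem eval_degenCode : ∀ (n : ℕ) (i : Fin (n + 1)), (degenCode n i).eval = i.predAbove
  | 0, _ => funext fun _ => Subsingleton.elim (α := Fin 1) _ _
  | n + 1, i => by
    induction i using Fin.cases with
    | zero =>
      funext j
      induction j using Fin.cases with
      | zero => rfl
      | succ j =>
        induction j using Fin.cases with
        | zero => rfl
        | succ j =>
          refine (congrArg Fin.succ (congrFun (eval_idCode (n + 1)) j)).trans ?_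
          exact (Fin.predAbove_zero_succ).symm
    | succ i =>
      funext j
      induction j using Fin.cases with
      | zero => rfl
      | succ j =>
        refine (congrArg Fin.succ (congrFun (eval_degenCode n i) j)).trans ?_
        exact (Fin.succ_predAbove_succ i j).symm

/-- The code of the map from the empty set. -/
def emptyCode : ∀ n : ℕ, MonoCode 0 n
  | 0 => nil
  | n + 1 => skip (emptyCode n)

variable {C : Type v} [Category.{w} C] (K : Comonad C) (X : C)

/-- The map `Kⁿ X → Kᵐ X` given by (the code of) an order-preserving map. A map that omits `0` acts
through the counit, and one that sends `0` to `0` acts by coextension. -/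
def act : ∀ {m n : ℕ}, MonoCode m n → (iterK K X n ⟶ iterK K X m)
  | _, _, nil => 𝟙 X
  | _, n + 1, skip c => K.ε.app (iterK K X n) ≫ act c
  | _, n + 1, hit c => K.δ.app (iterK K X n) ≫ K.map (act c)

/-- `hit (skip c)` is the code of `c` preceded by a new least element on both sides. -/
theorem act_hit_skip {m n : ℕ} (c : MonoCode m n) :
    act K X (hit (skip c)) = K.map (act K X c) := by
  change K.δ.app _ ≫ K.map (K.ε.app _ ≫ act K X c) = _
  rw [K.map_comp]
  exact (Category.assoc _ _ _).symm.trans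
    ((congrArg (· ≫ K.map (act K X c)) (K.right_counit _)).trans (Category.id_comp _))

theorem act_idCode : ∀ n : ℕ, act K X (idCode n) = 𝟙 (iterK K X n)
  | 0 => rfl
  | n + 1 => (act_hit_skip K X _).trans
    ((congrArg K.map (act_idCode n)).trans (K.map_id _))

theorem act_faceCode : ∀ (n : ℕ) (i : Fin (n + 1)), act K X (faceCode n i) = iterFace K X n i
  | 0, _ => Category.comp_id _
  | n + 1, i => by
    induction i using Fin.cases with
    | zero => exact (congrArg (K.ε.app _ ≫ ·) (act_idCode K X (n + 1))).trans (Category.comp_id _)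
    | succ i => exact (act_hit_skip K X _).trans (congrArg K.map (act_faceCode n i))

theorem act_hit_idCode (n : ℕ) :
    act K X (hit (idCode (n + 1))) = K.δ.app (iterK K X n) := by
  change K.δ.app _ ≫ K.map (act K X (idCode (n + 1))) = _
  rw [act_idCode]
  exact (congrArg (K.δ.app _ ≫ ·) (K.map_id _)).trans (Category.comp_id _)

theorem act_degenCode : ∀ (n : ℕ) (i : Fin (n + 1)), act K X (degenCode n i) = iterDegen K X n i
  | 0, _ => act_hit_idCode K X 0
  | n + 1, i => by
    induction i using Fin.cases with
    | zero => exact act_hit_idCode K X (n + 1)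
    | succ i => exact (act_hit_skip K X _).trans (congrArg K.map (act_degenCode n i))

theorem act_emptyCode : ∀ n : ℕ, act K X (emptyCode n) = iterAug K X n
  | 0 => rfl
  | n + 1 => congrArg (K.ε.app (iterK K X n) ≫ ·) (act_emptyCode n)

theorem coextend_comp_counit {A B D : C} (a : K.obj A ⟶ B) (b : B ⟶ D) :
    (K.δ.app A ≫ K.map a) ≫ K.ε.app B ≫ b = a ≫ b := by
  have h1 : K.map a ≫ K.ε.app B = K.ε.app (K.obj A) ≫ a := K.ε.naturality a
  have h2 : K.δ.app A ≫ K.ε.app (K.obj A) = 𝟙 _ := K.left_counit A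
  rw [Category.assoc, reassoc_of% h1, reassoc_of% h2]

theorem coextend_comp_coextend {A B D : C} (a : K.obj A ⟶ B) (b : K.obj B ⟶ D) :
    (K.δ.app A ≫ K.map a) ≫ K.δ.app B ≫ K.map b =
      K.δ.app A ≫ K.map ((K.δ.app A ≫ K.map a) ≫ b) := by
  have h1 : K.map a ≫ K.δ.app B = K.δ.app (K.obj A) ≫ K.map (K.map a) := K.δ.naturality a
  have h2 : K.δ.app A ≫ K.map (K.δ.app A) = K.δ.app A ≫ K.δ.app (K.obj A) := K.coassoc A
  rw [K.map_comp, K.map_comp, Category.assoc, Category.assoc, reassoc_of% h1, reassoc_of% h2]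

/-- Functoriality of `act`, for a code `h` of the composite `g ∘ f`. Where the first letter of `h`
does not fit those of `f` and `g`, the two maps disagree at `0`. -/
theorem act_comp : ∀ {l m n : ℕ} (f : MonoCode l m) (g : MonoCode m n) (h : MonoCode l n),
    (∀ i, h.eval i = g.eval (f.eval i)) → act K X h = act K X g ≫ act K X f
  | _, _, _, nil, nil, nil, _ => (Category.comp_id _).symm
  | _, _, _, f, skip g, skip h, e =>
    (congrArg (K.ε.app _ ≫ ·) (act_comp f g h fun i => Fin.succ_injective _ (e i))).trans
      (Category.assoc _ _ _).symm
  | _, _, _, _, skip _, hit _, e => absurd (e 0).symm (Fin.succ_ne_zero _)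
  | _, _, _, skip f, hit g, h, e =>
    (act_comp f g h e).trans (coextend_comp_counit K (act K X g) (act K X f)).symm
  | _, _, _, hit _, hit _, skip _, e => absurd (e 0) (Fin.succ_ne_zero _)
  | _, _, _, hit f, hit g, hit h, e =>
    (congrArg (fun t => K.δ.app _ ≫ K.map t) (act_comp f (hit g) h fun i => e i.succ)).trans
      (coextend_comp_coextend K (act K X g) (act K X f)).symm
  termination_by _ _ _ f g => sizeOf f + sizeOf g

end MonoCode

section

variable {C : Type v} [Category.{w} C] (K : Comonad C) (X : C)

/-- The code of a map of simplices. -/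
noncomputable def simplexCode {k l : SimplexCategory} (f : k ⟶ l) :
    MonoCode (k.len + 1) (l.len + 1) :=
  (MonoCode.exists_eval _ _ f.toOrderHom f.toOrderHom.monotone).choose

theorem eval_simplexCode {k l : SimplexCategory} (f : k ⟶ l) :
    (simplexCode f).eval = f.toOrderHom :=
  (MonoCode.exists_eval _ _ f.toOrderHom f.toOrderHom.monotone).choose_spec

/-- The comonad resolution of `X`, as a simplicial object. -/
noncomputable def resolution : SimplicialObject C where
  obj k := resObj K X k.unop.len
  map f := MonoCode.act K X (simplexCode f.unop)
  map_id k := by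
    rw [← MonoCode.act_idCode]
    exact congrArg (MonoCode.act K X) (MonoCode.eval_injective _ _
      ((eval_simplexCode _).trans (MonoCode.eval_idCode _).symm))
  map_comp f g := MonoCode.act_comp K X _ _ _ fun i => by
    rw [eval_simplexCode, eval_simplexCode, eval_simplexCode]; rfl

theorem resolution_δ (s : ℕ) (i : Fin (s + 2)) : (resolution K X).δ i = resFace K X s i := by
  refine Eq.trans ?_ (MonoCode.act_faceCode K X (s + 1) i)
  exact congrArg (MonoCode.act K X) (MonoCode.eval_injective _ _
    ((eval_simplexCode _).trans (MonoCode.eval_faceCode _ i).symm))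

theorem resolution_σ (s : ℕ) (i : Fin (s + 1)) : (resolution K X).σ i = resDegen K X s i := by
  refine Eq.trans ?_ (MonoCode.act_degenCode K X s i)
  exact congrArg (MonoCode.act K X) (MonoCode.eval_injective _ _
    ((eval_simplexCode _).trans (MonoCode.eval_degenCode _ i).symm))

/-- The augmentation is the action of the map from the empty set, so it is compatible with all
simplicial operators. -/
theorem resolution_map_aug {k l : SimplexCategoryᵒᵖ} (f : k ⟶ l) :
    (resolution K X).map f ≫ resAug K X l.unop.len = resAug K X k.unop.len := by
  have := MonoCode.act_comp K X (MonoCode.emptyCode _) (simplexCode f.unop)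
    (MonoCode.emptyCode _) fun i => i.elim0
  rw [MonoCode.act_emptyCode, MonoCode.act_emptyCode] at this
  exact this.symm

end

/-! ### Sections of Eilenberg-Mac Lane objects -/

section Sections

variable {O : Type u} {Q W : SimplexCategoryᵒᵖ ⥤ CatO O}

namespace Fib

variable (M : GrpOver Q)

/-- The identification of the fibres over equal arrows. -/
def castHom {k : SimplexCategoryᵒᵖ} {a b : O} {q q' : (Q.obj k).Arr a b} (h : q = q') :
    Fib M.proj q →+ Fib M.proj q' where
  toFun x := ⟨x.1, x.2.trans h⟩
  map_zero' := by subst h; rfl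
  map_add' x y := by subst h; rfl

/-- `Fib.map` as a homomorphism. -/
def mapHom {k l : SimplexCategoryᵒᵖ} (f : k ⟶ l) {a b : O} (q : (Q.obj k).Arr a b) :
    Fib M.proj q →+ Fib M.proj ((Q.map f).app q) :=
  AddMonoidHom.mk' (fun x => x.map f) (M.map_add f)

/-- `Fib.mul` as a homomorphism. -/
def mulHom {k : SimplexCategoryᵒᵖ} {a b c : O} (q : (Q.obj k).Arr a b) (r : (Q.obj k).Arr b c) :
    Fib M.proj q × Fib M.proj r →+ Fib M.proj ((Q.obj k).mul q r) :=
  AddMonoidHom.mk' (fun x => x.1.mul x.2) fun x y => M.mul_add x.1 y.1 x.2 y.2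

theorem one_eq_zero (k : SimplexCategoryᵒᵖ) (a : O) : Fib.one M.proj k a = 0 :=
  left_eq_add.1 (M.one_add k a).symm

theorem zero_val {k : SimplexCategoryᵒᵖ} {a : O} {q : (Q.obj k).Arr a a}
    (h : (Q.obj k).one a = q) : (0 : Fib M.proj q).1 = (M.tot.obj k).one a := by
  subst h
  exact congrArg Subtype.val (Fib.one_eq_zero M k a).symm

end Fib

variable {n : ℕ} {Z Z' : Idx (n + 1) ⥤ CatO O}

/-- The arrow of `Q` under an arrow of an object over `d⁽ⁿ⁾ Q`. -/
abbrev baseArr (β : Z ⟶ (dsc n O).obj Q) {j : Idx (n + 1)} {a b : O} (r : (Z.obj j).Arr a b) :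
    (Q.obj j.1).Arr a b := (β.app j).app r

theorem baseArr_map (β : Z ⟶ (dsc n O).obj Q) {j k : Idx (n + 1)} (f : j ⟶ k) {a b : O}
    (r : (Z.obj j).Arr a b) :
    (Q.map f.1).app (baseArr β r) = baseArr β ((Z.map f).app r) :=
  (CatO.naturality_app β f r).symm

theorem baseArr_one (β : Z ⟶ (dsc n O).obj Q) (j : Idx (n + 1)) (a : O) :
    (Q.obj j.1).one a = baseArr β ((Z.obj j).one a) :=
  ((β.app j).app_one a).symm

theorem baseArr_mul (β : Z ⟶ (dsc n O).obj Q) {j : Idx (n + 1)} {a b c : O}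
    (r : (Z.obj j).Arr a b) (s : (Z.obj j).Arr b c) :
    (Q.obj j.1).mul (baseArr β r) (baseArr β s) = baseArr β ((Z.obj j).mul r s) :=
  ((β.app j).app_mul r s).symm

/-- The group of maps over `d⁽ⁿ⁾ Q` from `β : Z → d⁽ⁿ⁾ Q` to `E⁽ⁿ⁺¹⁾(Q, M)`. Such a map is recorded by
its values in the fibres of `M`. There the conditions on it are equations between homomorphisms,
so the solutions are a subgroup of a product. -/
def sections (M : GrpOver Q) (β : Z ⟶ (dsc n O).obj Q) :
    AddSubgroup (∀ (j : Idx (n + 1)) (a b : O) (r : (Z.obj j).Arr a b) (_ : Pairs n j.2),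
      Fib M.proj (baseArr β r)) where
  carrier := {x |
    (∀ j a b r, IsCocycle n (x j a b r)) ∧
    (∀ (j k : Idx (n + 1)) (f : j ⟶ k) (a b : O) (r : (Z.obj j).Arr a b) (p : Pairs n k.2),
      x k a b ((Z.map f).app r) p = Fib.castHom M (baseArr_map β f r)
        (Fib.mapHom M f.1 _ (x j a b r (Pairs.map n f.2 p)))) ∧
    (∀ (j : Idx (n + 1)) (a : O) (p : Pairs n j.2), x j a a ((Z.obj j).one a) p = 0) ∧
    (∀ (j : Idx (n + 1)) (a b c : O) (r : (Z.obj j).Arr a b) (s : (Z.obj j).Arr b c)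
      (p : Pairs n j.2), x j a c ((Z.obj j).mul r s) p = Fib.castHom M (baseArr_mul β r s)
        (Fib.mulHom M _ _ (x j a b r p, x j b c s p)))}
  zero_mem' :=
    ⟨fun _ _ _ _ => IsCocycle.zero n _ fun _ => rfl,
      fun _ _ f _ _ _ _ => ((congrArg _ (map_zero (Fib.mapHom M f.1 _))).trans (map_zero _)).symm,
      fun _ _ _ => rfl,
      fun _ _ _ _ _ _ _ => ((congrArg _ (map_zero (Fib.mulHom M _ _))).trans (map_zero _)).symm⟩
  add_mem' hx hy :=
    ⟨fun j a b r => IsCocycle.map (fun z : Fib M.proj (baseArr β r) × Fib M.proj (baseArr β r) =>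
        z.1 + z.2) (fun _ _ => add_add_add_comm _ _ _ _) n
        (IsCocycle.prod n (hx.1 j a b r) (hy.1 j a b r)),
      fun j k f a b r p => (congrArg₂ _ (hx.2.1 j k f a b r p) (hy.2.1 j k f a b r p)).trans
        (((Fib.castHom M (baseArr_map β f r)).comp (Fib.mapHom M f.1 _)).map_add _ _).symm,
      fun j a p => (congrArg₂ _ (hx.2.2.1 j a p) (hy.2.2.1 j a p)).trans (add_zero _),
      fun j a b c r s p =>
        (congrArg₂ _ (hx.2.2.2 j a b c r s p) (hy.2.2.2 j a b c r s p)).trans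
        (((Fib.castHom M (baseArr_mul β r s)).comp (Fib.mulHom M _ _)).map_add _ _).symm⟩
  neg_mem' hx :=
    ⟨fun j a b r => IsCocycle.map (fun z : Fib M.proj (baseArr β r) => -z) neg_add
        n (hx.1 j a b r),
      fun j k f a b r p => (congrArg _ (hx.2.1 j k f a b r p)).trans
        (((Fib.castHom M (baseArr_map β f r)).comp (Fib.mapHom M f.1 _)).map_neg _).symm,
      fun j a p => (congrArg _ (hx.2.2.1 j a p)).trans neg_zero,
      fun j a b c r s p => (congrArg _ (hx.2.2.2 j a b c r s p)).trans
        (((Fib.castHom M (baseArr_mul β r s)).comp (Fib.mulHom M _ _)).map_neg _).symm⟩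

namespace sections

variable {M : GrpOver Q} {β : Z ⟶ (dsc n O).obj Q} {β' : Z' ⟶ (dsc n O).obj Q}

theorem ext {x y : sections M β}
    (h : ∀ j a b r p, (x.1 j a b r p).1 = (y.1 j a b r p).1) : x = y :=
  Subtype.ext (funext fun j => funext fun a => funext fun b => funext fun r => funext fun p =>
    Subtype.ext (h j a b r p))

theorem baseArr_comp {F : Z' ⟶ Z} (h : F ≫ β = β') {j : Idx (n + 1)} {a b : O}
    (r : (Z'.obj j).Arr a b) : baseArr β ((F.app j).app r) = baseArr β' r :=
  congrArg (fun t : Z' ⟶ (dsc n O).obj Q => (t.app j).app r) h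

/-- Precomposition of sections with a map over `d⁽ⁿ⁾ Q`. -/
def precomp (F : Z' ⟶ Z) (h : F ≫ β = β') : sections M β →+ sections M β' :=
  AddMonoidHom.mk'
    (fun x => ⟨fun j a b r p => Fib.castHom M (baseArr_comp h r) (x.1 j a b ((F.app j).app r) p),
      fun j a b r => IsCocycle.map _ (map_add (Fib.castHom M (baseArr_comp h r))) n (x.2.1 j a b _),
      fun j k f a b r p => by
        have h1 := congrArg Subtype.val (x.2.2.1 j k f a b ((F.app j).app r) p)
        have h2 := CatO.naturality_app F f r
        refine Subtype.ext (Eq.trans ?_ h1)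
        exact congrArg (fun t => (x.1 k a b t p).1) h2,
      fun j a p => by
        have h1 := (F.app j).app_one a
        subst h
        refine Eq.trans ?_ (congrArg (Fib.castHom M _) (x.2.2.2.1 j a p) |>.trans (map_zero
          (Fib.castHom M (congrArg (fun t => baseArr β t) h1.symm))))
        exact Subtype.ext (congrArg (fun t => (x.1 j a a t p).1) h1),
      fun j a b c r s p => by
        have h1 := congrArg Subtype.val (x.2.2.2.2 j a b c ((F.app j).app r) ((F.app j).app s) p)
        refine Subtype.ext (Eq.trans ?_ h1)
        exact congrArg (fun t => (x.1 j a c t p).1) ((F.app j).app_mul r s)⟩)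
    fun x y => Subtype.ext (funext fun j => funext fun a => funext fun b => funext fun r =>
      funext fun p => map_add (Fib.castHom M (baseArr_comp h r)) _ _)

end sections

/-- The groups of sections, as a presheaf on the category of objects over `d⁽ⁿ⁾ Q`. -/
def sectionsFunctor (n : ℕ) (M : GrpOver Q) : (Over ((dsc n O).obj Q))ᵒᵖ ⥤ AddCommGrpCat.{u} where
  obj Z := AddCommGrpCat.of (sections M Z.unop.hom)
  map F := AddCommGrpCat.ofHom (sections.precomp F.unop.left (Over.w F.unop))
  map_id Z := by
    ext
    rfl
  map_comp F G := by
    ext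
    rfl

namespace sections

variable {M : GrpOver Q} {f : W ⟶ Q} {β : Z ⟶ (dsc n O).obj W}

/-- A section over `Z → d⁽ⁿ⁾ W → d⁽ⁿ⁾ Q` as a map to `E⁽ⁿ⁺¹⁾(W, f^* M)`. -/
def toPb (x : sections M (β ≫ (dsc n O).map f)) : Z ⟶ EM n (M.pb f) where
  app j :=
    { app {a b} r :=
        { base := baseArr β r
          val p := ⟨(baseArr β r, (x.1 j a b r p).1), (x.1 j a b r p).2⟩
          mem p := rfl
          cocycle := IsCocycle.map (G' := Fib (M.pb f).proj (baseArr β r))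
            (M.pbFib f (baseArr β r)).symm
            (fun z z' => (M.pbFib f (baseArr β r)).injective (by
              refine Eq.trans ((M.pbFib f (baseArr β r)).apply_symm_apply _) ?_
              exact ((M.pbFib f (baseArr β r)).apply_symm_apply (z + z')).symm)) n
            (x.2.1 j a b r) }
      app_one a := EMArr.ext ((β.app j).app_one a) (funext fun p => Subtype.ext (Prod.ext
        ((β.app j).app_one a) ((congrArg Subtype.val (x.2.2.2.1 j a p)).trans
          (Fib.zero_val M (baseArr_one (β ≫ (dsc n O).map f) j a)))))
      app_mul {a b c} r s := EMArr.ext ((β.app j).app_mul r s) (funext fun p =>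
        Subtype.ext (Prod.ext ((β.app j).app_mul r s)
          (congrArg Subtype.val (x.2.2.2.2 j a b c r s p)))) }
  naturality j k g := CatO.hom_ext fun {a b} r => EMArr.ext (CatO.naturality_app β g r)
    (funext fun p => Subtype.ext (Prod.ext (CatO.naturality_app β g r)
      (congrArg Subtype.val (x.2.2.1 j k g a b r p))))

theorem toPb_proj (x : sections M (β ≫ (dsc n O).map f)) : toPb x ≫ EMproj n (M.pb f) = β := rfl

theorem toPb_injective : Function.Injective (toPb : sections M (β ≫ (dsc n O).map f) → _) :=
  fun _ _ h => sections.ext fun j _ _ r p =>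
    congrArg (fun g : Z ⟶ EM n (M.pb f) => (((g.app j).app r).val p).1.2) h

/-- The universal property of the pullback `E⁽ⁿ⁺¹⁾(W, f^* M)` of `E⁽ⁿ⁺¹⁾(Q, M)`. -/
theorem exists_toPb (g : Z ⟶ EM n (M.pb f)) (w : g ≫ EMproj n (M.pb f) = β) :
    ∃ x : sections M (β ≫ (dsc n O).map f), toPb x = g := by
  subst w
  refine ⟨⟨fun j a b r p => ⟨(((g.app j).app r).val p).1.2, (((g.app j).app r).val p).2.trans
    (congrArg (f.app j.1).app (((g.app j).app r).mem p))⟩, fun j a b r => ?_,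
    fun j k h a b r p => ?_, fun j a p => ?_, fun j a b c r s p => ?_⟩, ?_⟩
  · exact IsCocycle.map (G := Fib (M.pb f).proj ((g.app j).app r).base) (M.pbFib f _)
      (fun z z' => (M.pbFib f _).apply_symm_apply _) n ((g.app j).app r).cocycle
  · have h1 := CatO.naturality_app g h r
    exact Subtype.ext (congrArg (fun u : EMArr n (M.pb f) k.1 k.2 a b => (u.val p).1.2) h1)
  · have h1 := (g.app j).app_one a
    refine Subtype.ext (Eq.trans ?_
      (Fib.zero_val M (baseArr_one ((g ≫ EMproj n (M.pb f)) ≫ (dsc n O).map f) j a)).symm)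
    exact congrArg (fun u : EMArr n (M.pb f) j.1 j.2 a a => (u.val p).1.2) h1
  · have h1 := (g.app j).app_mul r s
    exact Subtype.ext (congrArg (fun u : EMArr n (M.pb f) j.1 j.2 a c => (u.val p).1.2) h1)
  · refine NatTrans.ext (funext fun j => CatO.hom_ext fun {a b} r => EMArr.ext rfl
      (funext fun p => Subtype.ext (Prod.ext ?_ rfl)))
    exact (((g.app j).app r).mem p).symm

/-- Maps to `E⁽ⁿ⁺¹⁾(W, f^* M)` over `d⁽ⁿ⁾ W` are sections over the composite to `d⁽ⁿ⁾ Q`. -/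
noncomputable def overEquiv (f : W ⟶ Q) (β : Z ⟶ (dsc n O).obj W) {β' : Z ⟶ (dsc n O).obj Q}
    (h : β ≫ (dsc n O).map f = β') :
    sections M β' ≃ (Over.mk β ⟶ Over.mk (EMproj n (M.pb f))) :=
  Equiv.ofBijective
    (fun x => Over.homMk (U := Over.mk β) (V := Over.mk (EMproj n (M.pb f)))
      (toPb (β := β) (f := f) (h ▸ x)) (toPb_proj _)) (by
    subst h
    exact ⟨fun x y e => toPb_injective (congrArg (fun g => g.left) e), fun g => by
      obtain ⟨x, hx⟩ := exists_toPb g.left (Over.w g)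
      exact ⟨x, Over.OverMorphism.ext hx⟩⟩)

theorem overEquiv_base (f : W ⟶ Q) (β : Z ⟶ (dsc n O).obj W) {β' : Z ⟶ (dsc n O).obj Q}
    (h : β ≫ (dsc n O).map f = β') (x : sections M β') {j : Idx (n + 1)} {a b : O}
    (r : (Z.obj j).Arr a b) :
    (((overEquiv f β h x).left.app j).app r).base = baseArr β r := by
  subst h; rfl

theorem overEquiv_val (f : W ⟶ Q) (β : Z ⟶ (dsc n O).obj W) {β' : Z ⟶ (dsc n O).obj Q}
    (h : β ≫ (dsc n O).map f = β') (x : sections M β') {j : Idx (n + 1)} {a b : O}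
    (r : (Z.obj j).Arr a b) (p : Pairs n j.2) :
    ((((overEquiv f β h x).left.app j).app r).val p).1.2 = (x.1 j a b r p).1 := by
  subst h; rfl

theorem overEquiv_isSum (f : W ⟶ Q) (β : Z ⟶ (dsc n O).obj W) {β' : Z ⟶ (dsc n O).obj Q}
    (h : β ≫ (dsc n O).map f = β') (x y : sections M β') (j : Idx (n + 1)) (a b : O)
    (r : (Z.obj j).Arr a b) :
    EMArr.IsSum (((overEquiv f β h x).left.app j).app r) (((overEquiv f β h y).left.app j).app r)
      (((overEquiv f β h (x + y)).left.app j).app r) := by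
  subst h
  exact ⟨rfl, rfl, fun p => rfl⟩

/-- Composed with the maps to `E⁽ⁿ⁺¹⁾(Q, M)`, the equivalences `overEquiv` turn precomposition of
sections into precomposition of maps, although the objects `E⁽ⁿ⁺¹⁾(W, f^* M)` differ. -/
theorem overEquiv_precomp {W' : SimplexCategoryᵒᵖ ⥤ CatO O} {f' : W' ⟶ Q}
    {γ : Z' ⟶ (dsc n O).obj W'} {β' : Z ⟶ (dsc n O).obj Q} {γ' : Z' ⟶ (dsc n O).obj Q}
    (h : β ≫ (dsc n O).map f = β') (h' : γ ≫ (dsc n O).map f' = γ') (F : Z' ⟶ Z)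
    (hF : F ≫ β' = γ') (x : sections M β') :
    (overEquiv f' γ h' (precomp F hF x)).left ≫ EMmap n M f' =
      F ≫ (overEquiv f β h x).left ≫ EMmap n M f := by
  refine NatTrans.ext (funext fun j => CatO.hom_ext fun {a b} r => EMArr.ext ?_ (funext fun p => ?_))
  · subst h
    exact (congrArg (f'.app j.1).app (overEquiv_base f' γ h' _ r)).trans
      (congrArg (fun t : Z' ⟶ (dsc n O).obj Q => (t.app j).app r) (h'.trans hF.symm))
  · exact (overEquiv_val f' γ h' _ r p).trans (overEquiv_val f β h x ((F.app j).app r) p).symm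

end sections

end Sections

/-! ### The cosimplicial abelian group -/

section Cosimplicial

variable {O : Type u} {n : ℕ}

/-- The canonical maps `Y → d⁽ⁿ⁾ p⁽¹⁾ Y` are natural in `Y`. -/
theorem toPOne_naturality {Z Y : Idx (n + 1) ⥤ CatO O} (F : Z ⟶ Y) :
    toPOne n Z ≫ (dsc n O).map ((pOne n O).map F) = F ≫ toPOne n Y :=
  NatTrans.ext (funext fun j =>
    (discrMap_hom catPi0 toCatPi0 toCatPi0_hom n (((slices n _).map F).app j.1) j.2).symm)

variable (X : NTrack (n + 1) O)

/-- The comonad resolution of `X`, over `d⁽ⁿ⁾ p⁽¹⁾ X`. -/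
noncomputable def resolutionOver :
    SimplexCategoryᵒᵖ ⥤ Over ((dsc n O).obj ((pOne n O).obj X.obj)) where
  obj k := Over.mk ((resAug (trackComonad (n + 1) O) X k.unop.len).hom ≫ toPOne n X.obj)
  map f := Over.homMk ((resolution (trackComonad (n + 1) O) X).map f).hom (by
    have := congrArg (fun t => t.hom ≫ toPOne n X.obj)
      (resolution_map_aug (trackComonad (n + 1) O) X f)
    exact (Category.assoc _ _ _).symm.trans this)
  map_id k := Over.OverMorphism.ext
    (congrArg (fun t => t.hom) ((resolution (trackComonad (n + 1) O) X).map_id k))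
  map_comp f g := Over.OverMorphism.ext
    (congrArg (fun t => t.hom) ((resolution (trackComonad (n + 1) O) X).map_comp f g))

/-- The sections over the comonad resolution of `X`. -/
noncomputable def resolutionSections (M : GrpOver ((pOne n O).obj X.obj)) :
    CosimplicialObject AddCommGrpCat.{u} :=
  (resolutionOver X).rightOp ⋙ sectionsFunctor n M

end Cosimplicial

theorem proposition4p8 {O : Type u} (n : ℕ) (X : NTrack (n + 1) O)
    (M : TrackModule ((pOne n O).obj X.obj)) :
    ∃ (D : CosimplicialObject AddCommGrpCat.{u})
      (e : ∀ s : ℕ, D.obj (SimplexCategory.mk s) ≃ DSet X M s),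
      (∀ (s : ℕ) (x y : D.obj (SimplexCategory.mk s)),
        DSet.IsSum X M (e s x) (e s y) (e s (x + y))) ∧
      (∀ (s : ℕ) (i : Fin (s + 2)) (x : D.obj (SimplexCategory.mk s)),
        DSet.toBase X M (e (s + 1) (D.δ i x)) =
          (resFace (trackComonad (n + 1) O) X s i).hom ≫ DSet.toBase X M (e s x)) ∧
      (∀ (s : ℕ) (i : Fin (s + 1)) (x : D.obj (SimplexCategory.mk (s + 1))),
        DSet.toBase X M (e s (D.σ i x)) =
          (resDegen (trackComonad (n + 1) O) X s i).hom ≫ DSet.toBase X M (e (s + 1) x)) := by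
  let e : ∀ s : ℕ, (resolutionSections X M.toGrpOver).obj (SimplexCategory.mk s) ≃ DSet X M s :=
    fun s => sections.overEquiv _ _
      (toPOne_naturality (resAug (trackComonad (n + 1) O) X s).hom)
  refine ⟨resolutionSections X M.toGrpOver, e,
    fun s x y j a b r => sections.overEquiv_isSum _ _ _ x y j a b r,
    fun s i x => ?_, fun s i x => ?_⟩
  · rw [← resolution_δ]
    exact sections.overEquiv_precomp (M := M.toGrpOver) _ _ _
      (Over.w ((resolutionOver X).map (SimplexCategory.δ i).op)) x
  · rw [← resolution_σ]
    exact sections.overEquiv_precomp (M := M.toGrpOver) _ _ _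
      (Over.w ((resolutionOver X).map (SimplexCategory.σ i).op)) x
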